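/- Let $\mathbb{T}$ be the unit circle and $L^2(\mathbb{T})$ the Hilbert space of square integrable complex functions with respect to normalised arc length $\frac{d\xi}{2\pi}$. Let $H^2\subset L^2(\mathbb{T})$ be the Hardy space (functions whose Fourier coefficients of negative order vanish) and $H^\infty=H^2\cap L^\infty$. Let $d\ge 1$, let $\lambda_1,\dots,\lambda_d$ be points of the open unit disc (not necessarily distinct) and let $B(z)=\prod_{i=1}^d\frac{z-\lambda_i}{1-\overline{\lambda_i}z}$ be the finite Blaschke product with these zeros. For $n\in\mathbb{N}$ let $K_{B^n}=H^2\cap(B^nH^2)^{\perp}$, a finite dimensional subspace of $H^\infty$. For $\phi\in L^2(\mathbb{T})$ let $T_\phi g=P_{H^2}(\phi g)$ for $g\in H^\infty$, and let $T_{\phi,K_{B^n}}f=P_{K_{B^n}}T_\phi f$ for $f\in K_{B^n}$, a linear operator on $K_{B^n}$. Let $M_1$ be the closed linear span of $\{B^t:t\in\mathbb{Z}\}$ in $L^2(\mathbb{T})$. Let $\phi\in M_1$. Then there is exactly one family $(a_n)_{n\in\mathbb{Z}}$ of complex numbers such that $\phi=\sum_{n\in\mathbb{Z}}a_nB^n$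 (unconditional convergence in $L^2(\mathbb{T})$); for this family the series $\varphi(z)=\sum_{n\in\mathbb{Z}}a_nz^n$ converges unconditionally in $L^2(\mathbb{T})$, and the following hold. 1. $T_\phi$ is distributed as $|\varphi|$ in the sense of the singular values relative to the sequence of model spaces $(K_{B^n})_{n\in\mathbb{N}}$: for every continuous function $G:\mathbb{R}\to\mathbb{C}$ with compact support, $$\lim_{n\to\infty}\frac{1}{\dim K_{B^n}}\sum_{k=1}^{\dim K_{B^n}}G\bigl(\sigma_k(T_{\phi,K_{B^n}})\bigr)=\frac1{2\pi}\int_{\mathbb{T}}G(|\varphi(\xi)|)\,d\xi,$$ where $\sigma_k(T_{\phi,K_{B^n}})$, $1\le k\le\dim K_{B^n}$, are the singular values of $T_{\phi,K_{B^n}}$ repeated according to multiplicity. 2. If $\phi$ is real valued (almost everywhere), then $T_\phi$ is distributed as $\varphi$ in the sense of the eigenvalues relative to $(K_{B^n})_{n\in\mathbb{N}}$: for every continuous function $G:\mathbb{C}\to\mathbb{C}$ with compact support, $$\lim_{n\to\infty}\frac{1}{\dim K_{B^n}}\sum_{k=1}^{\dim K_{B^n}}G\bigl(\lambda_k(T_{\phi,K_{B^n}})\bigr)=\frac1{2\pi}\int_{\mathbb{T}}G(\varphi(\xi))\,d\xi,$$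 where $\lambda_k(T_{\phi,K_{B^n}})$, $1\le k\le\dim K_{B^n}$, are the eigenvalues of $T_{\phi,K_{B^n}}$ repeated according to algebraic multiplicity. -/

import Mathlib

open MeasureTheory Filter Topology ComplexConjugate
open scoped ENNReal Complex.UnitDisc InnerProductSpace

noncomputable section

namespace SzegoModel

instance instFactTwoPiPos : Fact (0 < 2 * Real.pi) := ⟨Real.two_pi_pos⟩

/-- The unit circle, parametrised by `t ↦ e^{it}`, `t ∈ ℝ / 2πℤ`. -/
abbrev Torus : Type := AddCircle (2 * Real.pi)

/-- Normalised arc length `dξ / 2π` on the circle. -/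
abbrev arc : Measure Torus := AddCircle.haarAddCircle

/-- `L²(𝕋)` for normalised arc length. -/
abbrev L2 : Type := Lp ℂ 2 arc

/-- The point `e^{it}` of the unit circle. -/
def pt (t : Torus) : ℂ := (AddCircle.toCircle t : ℂ)

lemma norm_pt (t : Torus) : ‖pt t‖ = 1 := Circle.norm_coe _

lemma continuous_pt : Continuous pt :=
  continuous_induced_dom.comp AddCircle.continuous_toCircle

lemma pt_ne_zero (t : Torus) : pt t ≠ 0 := by
  intro h; have := norm_pt t; simp [h] at this

lemma conj_pt (t : Torus) : conj (pt t) * pt t = 1 := by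
  rw [mul_comm, Complex.mul_conj, Complex.normSq_eq_norm_sq, norm_pt]; simp

lemma fourier_eq_zpow (n : ℤ) (t : Torus) : fourier n t = pt t ^ n := by
  simp [fourier_apply, AddCircle.toCircle_zsmul, pt]

/-! ### Hardy space -/

lemma fourierCoeff_eq_repr (f : L2) (n : ℤ) :
    fourierCoeff f n = fourierBasis.repr f n := (fourierBasis_repr f n).symm

/-- The Hardy space `H²`: the functions in `L²(𝕋)` whose Fourier coefficients of negative order
vanish. -/
def hardy : Submodule ℂ L2 where
  carrier := {f | ∀ n : ℤ, n < 0 → fourierCoeff f n = 0}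
  add_mem' {f g} hf hg n hn := by
    have h1 := hf n hn
    have h2 := hg n hn
    rw [fourierCoeff_eq_repr] at h1 h2 ⊢
    simp [h1, h2]
  zero_mem' n _ := by rw [fourierCoeff_eq_repr]; simp
  smul_mem' c f hf n hn := by
    have h1 := hf n hn
    rw [fourierCoeff_eq_repr] at h1 ⊢
    simp [h1]

lemma mem_hardy {f : L2} : f ∈ hardy ↔ ∀ n : ℤ, n < 0 → fourierCoeff f n = 0 := Iff.rfl

lemma isClosed_hardy : IsClosed (hardy : Set L2) := by
  have : (hardy : Set L2) = ⋂ n : ℤ, ⋂ _ : n < 0, {f : L2 | ⟪fourierBasis n, f⟫_ℂ = 0} := by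
    ext f
    simp [mem_hardy, fourierCoeff_eq_repr, HilbertBasis.repr_apply_apply]
  rw [this]
  refine isClosed_iInter fun n => isClosed_iInter fun _ => ?_
  exact isClosed_eq (by fun_prop) continuous_const

instance instCompleteHardy : CompleteSpace hardy := isClosed_hardy.completeSpace_coe

/-- `H^∞ = H² ∩ L^∞`. -/
def hardyInf : Submodule ℂ L2 where
  carrier := {f | f ∈ hardy ∧ MemLp f ∞ arc}
  add_mem' {f g} hf hg :=
    ⟨hardy.add_mem hf.1 hg.1, (hf.2.add hg.2).ae_eq (Lp.coeFn_add f g).symm⟩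
  zero_mem' := ⟨hardy.zero_mem, (MemLp.zero' (ε := ℂ)).ae_eq (Lp.coeFn_zero ℂ 2 arc).symm⟩
  smul_mem' c f hf :=
    ⟨hardy.smul_mem c hf.1, (hf.2.const_smul c).ae_eq (Lp.coeFn_smul c f).symm⟩

lemma memLp_mul (ϕ : L2) {g : Torus → ℂ} (hg : MemLp g ∞ arc) :
    MemLp (fun t => ϕ t * g t) 2 arc :=
  hg.mul' (Lp.memLp ϕ)

/-- The Toeplitz operator `T_ϕ g = P_{H²}(ϕ g)` with symbol `ϕ ∈ L²(𝕋)`, defined on `H^∞`. -/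
def toeplitz (ϕ : L2) : hardyInf →ₗ[ℂ] hardy where
  toFun g := hardy.orthogonalProjectionOnto ((memLp_mul ϕ g.2.2).toLp _)
  map_add' f g := by
    rw [← map_add, ← MemLp.toLp_add]
    congr 1
    refine MemLp.toLp_congr _ _ ?_
    filter_upwards [Lp.coeFn_add (f : L2) g] with t ht
    simp only [Submodule.coe_add, ht, Pi.add_apply, mul_add]
  map_smul' c g := by
    rw [RingHom.id_apply, ← map_smul, ← MemLp.toLp_const_smul]
    congr 1
    refine MemLp.toLp_congr _ _ ?_
    filter_upwards [Lp.coeFn_smul c (g : L2)] with t ht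
    simp only [Submodule.coe_smul, ht, Pi.smul_apply, smul_eq_mul]
    ring

/-! ### Model spaces -/

/-- `θ H² = {θ g : g ∈ H²}` (inside `L²(𝕋)`). -/
def mulHardy (θ : Torus → ℂ) : Submodule ℂ L2 where
  carrier := {h | ∃ g ∈ hardy, h =ᵐ[arc] fun t => θ t * g t}
  add_mem' := by
    rintro h₁ h₂ ⟨g₁, hg₁, e₁⟩ ⟨g₂, hg₂, e₂⟩
    refine ⟨g₁ + g₂, hardy.add_mem hg₁ hg₂, ?_⟩
    filter_upwards [e₁, e₂, Lp.coeFn_add h₁ h₂, Lp.coeFn_add g₁ g₂] with t a b c e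
    rw [c, e, Pi.add_apply, Pi.add_apply, a, b, mul_add]
  zero_mem' := by
    refine ⟨0, hardy.zero_mem, ?_⟩
    filter_upwards [Lp.coeFn_zero ℂ 2 arc] with t a
    rw [a, Pi.zero_apply, mul_zero]
  smul_mem' := by
    rintro c h ⟨g, hg, e⟩
    refine ⟨c • g, hardy.smul_mem c hg, ?_⟩
    filter_upwards [e, Lp.coeFn_smul c h, Lp.coeFn_smul c g] with t a b e
    rw [b, e, Pi.smul_apply, Pi.smul_apply, a, smul_eq_mul, smul_eq_mul, mul_left_comm]

/-- The model space `K_θ = H² ⊖ θ H² = H² ∩ (θ H²)^⊥`. -/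
def modelSpace (θ : Torus → ℂ) : Submodule ℂ L2 := hardy ⊓ (mulHardy θ)ᗮ

/-- The compression `T_{ϕ,K} = P_K T_ϕ P_K` to a finite dimensional subspace `K ⊆ H^∞` of the
Toeplitz operator with symbol `ϕ ∈ L²(𝕋)`, as an operator on `K`. -/
def compression (ϕ : L2) (K : Submodule ℂ L2) [FiniteDimensional ℂ K] (hK : K ≤ hardyInf) :
    K →ₗ[ℂ] K :=
  (K.orthogonalProjectionOnto : L2 →ₗ[ℂ] K) ∘ₗ hardy.subtype ∘ₗ toeplitz ϕ ∘ₗ Submodule.inclusion hK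

/-! ### Finite Blaschke products -/

/-- The finite Blaschke product `B(z) = ∏ (z - λᵢ) / (1 - conj λᵢ z)` with zeros `λ₁, …, λ_d`
in the open unit disc, repeated according to multiplicity. -/
def blaschke {d : ℕ} (lam : Fin d → 𝔻) (z : ℂ) : ℂ :=
  ∏ i, (z - lam i) / (1 - conj (lam i : ℂ) * z)

lemma den_ne_zero (l : 𝔻) (t : Torus) : 1 - conj (l : ℂ) * pt t ≠ 0 := by
  intro h
  have h1 : ‖conj (l : ℂ) * pt t‖ = 1 := by rw [← sub_eq_zero.1 h]; simp
  rw [norm_mul, norm_pt, mul_one, RCLike.norm_conj] at h1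
  exact absurd h1 l.norm_lt_one.ne

lemma conj_num (l : 𝔻) (t : Torus) :
    conj (pt t - (l : ℂ)) * pt t = 1 - conj (l : ℂ) * pt t := by
  rw [map_sub, sub_mul, conj_pt]

lemma num_ne_zero (l : 𝔻) (t : Torus) : pt t - (l : ℂ) ≠ 0 := by
  intro h
  have := conj_num l t
  rw [h] at this
  exact den_ne_zero l t (by rw [← this]; simp)

lemma blaschke_ne_zero {d : ℕ} (lam : Fin d → 𝔻) (t : Torus) : blaschke lam (pt t) ≠ 0 :=
  Finset.prod_ne_zero_iff.2 fun i _ => div_ne_zero (num_ne_zero _ _) (den_ne_zero _ _)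

/-- The powers `Bⁿ`, `n ∈ ℤ`, as continuous functions on the circle. -/
def blaschkePow {d : ℕ} (lam : Fin d → 𝔻) (n : ℤ) : C(Torus, ℂ) where
  toFun t := blaschke lam (pt t) ^ n
  continuous_toFun := by
    refine Continuous.zpow₀ ?_ n fun t => Or.inl (blaschke_ne_zero lam t)
    unfold blaschke
    refine continuous_finsetProd _ fun _ _ => ?_
    exact (continuous_pt.sub continuous_const).div
      (continuous_const.sub (continuous_const.mul continuous_pt)) fun t => den_ne_zero _ t

/-- The powers `Bⁿ`, `n ∈ ℤ`, as elements of `L²(𝕋)`. -/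
def blaschkeLp {d : ℕ} (lam : Fin d → 𝔻) (n : ℤ) : L2 :=
  ContinuousMap.toLp 2 arc ℂ (blaschkePow lam n)

/-- The space `M₁`, the closed linear span in `L²(𝕋)` of the powers `Bⁿ`, `n ∈ ℤ`. -/
def spaceM₁ {d : ℕ} (lam : Fin d → 𝔻) : Submodule ℂ L2 :=
  (Submodule.span ℂ (Set.range (blaschkeLp lam))).topologicalClosure

/-- The model space `K_{Bⁿ}`. -/
def blaschkeModel {d : ℕ} (lam : Fin d → 𝔻) (n : ℕ) : Submodule ℂ L2 :=
  modelSpace (blaschkePow lam n)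

/-! ### The spaces `K_{Bⁿ}` are finite dimensional and contained in `H^∞`

If `f ∈ K_{Bⁿ}` and `q` is the denominator of `Bⁿ`, then `q f` is a polynomial of degree less
than `n d`. -/

/-- The denominator of `Bⁿ`, as a polynomial. -/
def denPoly {d : ℕ} (lam : Fin d → 𝔻) (n : ℕ) : Polynomial ℂ :=
  ∏ i, (1 - Polynomial.C (conj (lam i : ℂ)) * Polynomial.X) ^ n

/-- The numerator of `Bⁿ`, as a polynomial. -/
def numPoly {d : ℕ} (lam : Fin d → 𝔻) (n : ℕ) : Polynomial ℂ :=
  ∏ i, (Polynomial.X - Polynomial.C (lam i : ℂ)) ^ n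

lemma denPoly_ne_zero {d : ℕ} (lam : Fin d → 𝔻) (n : ℕ) (t : Torus) :
    (denPoly lam n).eval (pt t) ≠ 0 := by
  simp only [denPoly, Polynomial.eval_prod, Polynomial.eval_pow, Polynomial.eval_sub,
    Polynomial.eval_one, Polynomial.eval_mul, Polynomial.eval_C, Polynomial.eval_X]
  exact Finset.prod_ne_zero_iff.2 fun i _ => pow_ne_zero _ (den_ne_zero _ t)

lemma blaschkePow_mul_den {d : ℕ} (lam : Fin d → 𝔻) (n : ℕ) (t : Torus) :
    blaschkePow lam n t * (denPoly lam n).eval (pt t) = (numPoly lam n).eval (pt t) := by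
  simp only [blaschkePow, ContinuousMap.coe_mk, blaschke, denPoly, numPoly, Polynomial.eval_prod,
    Polynomial.eval_pow, Polynomial.eval_sub, Polynomial.eval_one, Polynomial.eval_mul,
    Polynomial.eval_C, Polynomial.eval_X, zpow_natCast, ← Finset.prod_pow,
    ← Finset.prod_mul_distrib, ← mul_pow]
  exact Finset.prod_congr rfl fun i _ => by rw [div_mul_cancel₀ _ (den_ne_zero _ t)]

lemma conj_num_mul {d : ℕ} (lam : Fin d → 𝔻) (n : ℕ) (t : Torus) :
    conj ((numPoly lam n).eval (pt t)) * pt t ^ (n * d) = (denPoly lam n).eval (pt t) := by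
  simp only [denPoly, numPoly, Polynomial.eval_prod,
    Polynomial.eval_pow, Polynomial.eval_sub, Polynomial.eval_one, Polynomial.eval_mul,
    Polynomial.eval_C, Polynomial.eval_X, map_prod, map_pow, pow_mul]
  have : (pt t ^ n) ^ d = ∏ _i : Fin d, pt t ^ n := by simp
  rw [this, ← Finset.prod_mul_distrib]
  exact Finset.prod_congr rfl fun i _ => by rw [← mul_pow, conj_num]

lemma continuous_eval (P : Polynomial ℂ) : Continuous fun t : Torus => P.eval (pt t) :=
  P.continuous.comp continuous_pt

lemma memLp_top_of_continuous {g : Torus → ℂ} (hg : Continuous g) : MemLp g ∞ arc :=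
  (ContinuousMap.memLp (p := ∞) arc ℂ (⟨g, hg⟩ : C(Torus, ℂ)))

/-- Multiplication of an `L²` function by a polynomial in `e^{it}`. -/
def polyMul (P : Polynomial ℂ) (f : L2) : L2 :=
  (memLp_mul f (memLp_top_of_continuous (continuous_eval P))).toLp _

lemma polyMul_ae (P : Polynomial ℂ) (f : L2) :
    polyMul P f =ᵐ[arc] fun t => f t * P.eval (pt t) := MemLp.coeFn_toLp _

lemma fourierCoeff_polyMul (P : Polynomial ℂ) (f : L2) (k : ℤ) :
    fourierCoeff (polyMul P f) k = ∑ j ∈ P.support, P.coeff j * fourierCoeff f (k - j) := by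
  have hint : Integrable f arc := (Lp.memLp f).integrable (by norm_num)
  have e : ∀ᵐ t ∂arc, fourier (-k) t • polyMul P f t
      = ∑ j ∈ P.support, P.coeff j * (fourier (-(k - j)) t • f t) := by
    filter_upwards [polyMul_ae P f] with t ht
    rw [ht, Polynomial.eval_eq_sum, Polynomial.sum, Finset.mul_sum, Finset.smul_sum]
    refine Finset.sum_congr rfl fun j _ => ?_
    have : pt t ^ (-(k - (j : ℤ))) = pt t ^ (-k) * pt t ^ j := by
      rw [← zpow_natCast, ← zpow_add₀ (pt_ne_zero t)]; congr 1; ring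
    simp only [fourier_eq_zpow, smul_eq_mul, this]
    ring
  rw [fourierCoeff, integral_congr_ae e, integral_finsetSum]
  · refine Finset.sum_congr rfl fun j _ => ?_
    rw [integral_const_mul]; rfl
  · intro j _
    exact (hint.fourier_smul _).const_mul _

lemma polyMul_mem_hardy (P : Polynomial ℂ) {f : L2} (hf : f ∈ hardy) : polyMul P f ∈ hardy := by
  intro k hk
  rw [fourierCoeff_polyMul]
  refine Finset.sum_eq_zero fun j _ => ?_
  rw [hf _ (by omega), mul_zero]

lemma fourierLp_mem_hardy (j : ℕ) : (fourierLp 2 (j : ℤ) : L2) ∈ hardy := by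
  intro k hk
  rw [fourierCoeff_eq_repr, HilbertBasis.repr_apply_apply, coe_fourierBasis]
  exact orthonormal_fourier.2 (by omega)

/-- The functions `e^{ikt} / q(e^{it})`, where `q` is the denominator of `Bⁿ`. -/
def modelGen {d : ℕ} (lam : Fin d → 𝔻) (n : ℕ) (k : ℕ) : C(Torus, ℂ) where
  toFun t := pt t ^ k / (denPoly lam n).eval (pt t)
  continuous_toFun := (continuous_pt.pow k).div (continuous_eval _) (denPoly_ne_zero lam n)

lemma fourierCoeff_den_mul {d : ℕ} (lam : Fin d → 𝔻) (n : ℕ) {f : L2}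
    (hf : f ∈ blaschkeModel lam n) (k : ℤ) (hk : k < 0 ∨ (n * d : ℕ) ≤ k) :
    fourierCoeff (polyMul (denPoly lam n) f) k = 0 := by
  rcases hk with hk | hk
  · exact polyMul_mem_hardy _ hf.1 k hk
  obtain ⟨j, rfl⟩ : ∃ j : ℕ, k = (n * d : ℕ) + j := ⟨(k - (n * d : ℕ)).toNat, by omega⟩
  have hmem : polyMul (numPoly lam n) (fourierLp 2 (j : ℤ)) ∈ mulHardy (blaschkePow lam n) := by
    refine ⟨polyMul (denPoly lam n) (fourierLp 2 (j : ℤ)),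
      polyMul_mem_hardy _ (fourierLp_mem_hardy j), ?_⟩
    filter_upwards [polyMul_ae (numPoly lam n) (fourierLp 2 (j : ℤ)),
      polyMul_ae (denPoly lam n) (fourierLp 2 (j : ℤ))] with t h1 h2
    rw [h1, h2, ← blaschkePow_mul_den]; ring
  have h0 := (Submodule.mem_orthogonal _ _).1 hf.2 _ hmem
  rw [L2.inner_def] at h0
  rw [fourierCoeff, ← h0]
  refine integral_congr_ae ?_
  filter_upwards [polyMul_ae (numPoly lam n) (fourierLp 2 (j : ℤ)),
    polyMul_ae (denPoly lam n) f, coeFn_fourierLp (T := 2 * Real.pi) 2 (j : ℤ)] with t h1 h2 h3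
  rw [h1, h2, h3, RCLike.inner_apply, smul_eq_mul, ← conj_num_mul, fourier_eq_zpow,
    fourier_eq_zpow, map_mul, zpow_natCast, map_pow]
  have e1 : pt t ^ (-(((n * d : ℕ) : ℤ) + j)) * pt t ^ (n * d) * pt t ^ j = 1 := by
    rw [← zpow_natCast, ← zpow_natCast, ← zpow_add₀ (pt_ne_zero t), ← zpow_add₀ (pt_ne_zero t)]
    simp
  have e2 : conj (pt t) ^ j * pt t ^ j = 1 := by rw [← mul_pow, conj_pt, one_pow]
  have e3 : pt t ^ (-(((n * d : ℕ) : ℤ) + j)) * pt t ^ (n * d) = conj (pt t) ^ j :=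
    mul_right_cancel₀ (pow_ne_zero j (pt_ne_zero t)) (e1.trans e2.symm)
  rw [← e3]; ring

lemma blaschkeModel_le_span {d : ℕ} (lam : Fin d → 𝔻) (n : ℕ) :
    blaschkeModel lam n ≤ Submodule.span ℂ ((fun k : ℕ =>
      ContinuousMap.toLp 2 arc ℂ (modelGen lam n k)) '' (Finset.range (n * d) : Set ℕ)) := by
  intro f hf
  set g := polyMul (denPoly lam n) f with hg
  set s : Finset ℤ := (Finset.range (n * d)).map Nat.castEmbedding with hs
  have hsum : g = ∑ k ∈ Finset.range (n * d), fourierCoeff g (k : ℤ) • fourierLp 2 (k : ℤ) := by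
    have h1 := hasSum_fourier_series_L2 g
    have h2 : HasSum (fun i : ℤ => fourierCoeff g i • (fourierLp 2 i : L2))
        (∑ i ∈ s, fourierCoeff g i • fourierLp 2 i) := by
      refine hasSum_sum_of_ne_finset_zero fun k hk => ?_
      rw [hg, fourierCoeff_den_mul lam n hf k, zero_smul]
      by_contra! hcon
      apply hk
      simp only [hs, Finset.mem_map, Finset.mem_range, Nat.castEmbedding_apply]
      exact ⟨k.toNat, by omega, by omega⟩
    refine (h1.unique h2).trans ?_
    rw [hs, Finset.sum_map]
    rfl
  have hf' : f = ∑ k ∈ Finset.range (n * d), fourierCoeff g (k : ℤ) •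
      ContinuousMap.toLp 2 arc ℂ (modelGen lam n k) := by
    have e1 : ∑ k ∈ Finset.range (n * d), fourierCoeff g (k : ℤ) • (fourierLp 2 (k : ℤ) : L2)
        = ContinuousMap.toLp 2 arc ℂ
          (∑ k ∈ Finset.range (n * d), fourierCoeff g (k : ℤ) • fourier (k : ℤ)) := by
      simp [map_sum, map_smul]
    have e2 : ∑ k ∈ Finset.range (n * d), fourierCoeff g (k : ℤ) •
        ContinuousMap.toLp 2 arc ℂ (modelGen lam n k) = ContinuousMap.toLp 2 arc ℂ
          (∑ k ∈ Finset.range (n * d), fourierCoeff g (k : ℤ) • modelGen lam n k) := by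
      simp [map_sum, map_smul]
    rw [e1] at hsum
    rw [e2]
    apply Lp.ext
    have hg' : g =ᵐ[arc] (∑ k ∈ Finset.range (n * d), fourierCoeff g (k : ℤ) •
        (fourier (k : ℤ) : C(Torus, ℂ)) : C(Torus, ℂ)) := by
      nth_rw 1 [hsum]
      exact ContinuousMap.coeFn_toLp (p := 2) (𝕜 := ℂ) arc _
    filter_upwards [hg', polyMul_ae (denPoly lam n) f,
      ContinuousMap.coeFn_toLp (p := 2) (𝕜 := ℂ) arc
        (∑ k ∈ Finset.range (n * d), fourierCoeff g (k : ℤ) • modelGen lam n k)] with t h1 h2 h3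
    rw [h3]
    have hne := denPoly_ne_zero lam n t
    have h4 : f t = g t / (denPoly lam n).eval (pt t) := by
      rw [hg, h2, mul_div_cancel_right₀ _ hne]
    rw [h4, h1]
    simp only [ContinuousMap.coe_sum, Finset.sum_apply, ContinuousMap.coe_smul, Pi.smul_apply,
      Finset.sum_div, smul_eq_mul, fourier_eq_zpow, zpow_natCast, modelGen, ContinuousMap.coe_mk,
      mul_div_assoc]
  rw [hf']
  exact Submodule.sum_mem _ fun k hk => Submodule.smul_mem _ _
    (Submodule.subset_span ⟨k, by simpa using hk, rfl⟩)

instance instFiniteDimensionalBlaschkeModel {d : ℕ} (lam : Fin d → 𝔻) (n : ℕ) :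
    FiniteDimensional ℂ (blaschkeModel lam n) := by
  have : FiniteDimensional ℂ (Submodule.span ℂ ((fun k : ℕ =>
      ContinuousMap.toLp 2 arc ℂ (modelGen lam n k)) '' (Finset.range (n * d) : Set ℕ))) :=
    FiniteDimensional.span_of_finite ℂ (((Finset.range (n * d)).finite_toSet).image _)
  exact Submodule.finiteDimensional_of_le (blaschkeModel_le_span lam n)

lemma blaschkeModel_le_hardyInf {d : ℕ} (lam : Fin d → 𝔻) (n : ℕ) :
    blaschkeModel lam n ≤ hardyInf := by
  intro f hf
  refine ⟨hf.1, ?_⟩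
  refine Submodule.span_induction (p := fun (h : L2) _ => MemLp h ∞ arc) ?_ ?_ ?_ ?_
    (blaschkeModel_le_span lam n hf)
  · rintro _ ⟨k, _, rfl⟩
    exact (memLp_top_of_continuous (modelGen lam n k).continuous).ae_eq
      (ContinuousMap.coeFn_toLp (p := 2) (𝕜 := ℂ) arc _).symm
  · exact (MemLp.zero' (ε := ℂ)).ae_eq (Lp.coeFn_zero ℂ 2 arc).symm
  · intro f g _ _ hf hg
    exact (hf.add hg).ae_eq (Lp.coeFn_add f g).symm
  · intro c f _ hf
    exact (hf.const_smul c).ae_eq (Lp.coeFn_smul c f).symm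

/-! ### Distribution of eigenvalues and singular values -/

/-- The operator `T_{ϕ, K_{Bⁿ}}`. -/
def blaschkeCompression {d : ℕ} (lam : Fin d → 𝔻) (ϕ : L2) (n : ℕ) :
    blaschkeModel lam n →ₗ[ℂ] blaschkeModel lam n :=
  compression ϕ (blaschkeModel lam n) (blaschkeModel_le_hardyInf lam n)

/-- `T_ϕ` is distributed as `g` in the sense of the eigenvalues relative to `(K_{Bⁿ})ₙ`: for every
continuous compactly supported `G`, the mean of `G` over the eigenvalues of `T_{ϕ, K_{Bⁿ}}`
(repeated according to algebraic multiplicity) tends to `(1/2π) ∫_𝕋 G(g(ξ)) dξ`. -/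
def EigenDistributed {d : ℕ} (lam : Fin d → 𝔻) (ϕ : L2) (g : Torus → ℂ) : Prop :=
  ∀ G : ℂ → ℂ, Continuous G → HasCompactSupport G →
    Tendsto
      (fun n : ℕ => ((Module.finrank ℂ (blaschkeModel lam n) : ℂ))⁻¹ *
        ((blaschkeCompression lam ϕ n).charpoly.roots.map G).sum)
      atTop (𝓝 (∫ t, G (g t) ∂arc))

/-- `T_ϕ` is distributed as `g` in the sense of the singular values relative to `(K_{Bⁿ})ₙ`: for
every continuous compactly supported `G`, the mean of `G` over the `dim K_{Bⁿ}` singular values of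
`T_{ϕ, K_{Bⁿ}}` tends to `(1/2π) ∫_𝕋 G(g(ξ)) dξ`. -/
def SingularDistributed {d : ℕ} (lam : Fin d → 𝔻) (ϕ : L2) (g : Torus → ℝ) : Prop :=
  ∀ G : ℝ → ℂ, Continuous G → HasCompactSupport G →
    Tendsto
      (fun n : ℕ => ((Module.finrank ℂ (blaschkeModel lam n) : ℂ))⁻¹ *
        ∑ k ∈ Finset.range (Module.finrank ℂ (blaschkeModel lam n)),
          G ((blaschkeCompression lam ϕ n).singularValues k))
      atTop (𝓝 (∫ t, G (g t) ∂arc))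

end SzegoModel

end

open SzegoModel

/-! ### Spectral comparison in the Hilbert–Schmidt norm -/

section LinearAlgebra

variable {E : Type*} [NormedAddCommGroup E] [InnerProductSpace ℂ E]
  {ι κ : Type*} [Fintype ι] [Fintype κ]

/-! Multiplication by `B` is unitary on `L²` and maps `H²` into itself, and `K_{Bⁿ}` is the
orthogonal sum of the spaces `B^j K_B`, `0 ≤ j < n`. If `e_i` is an orthonormal basis of `K_B`, then
in the basis `B^j e_i` the compression of `ϕ = ∑ a_m B^m` has entries `a_{k-j} δ_{il}`
(`isBlockToeplitz_blaschkeCompression`): it is `d` copies of the classical `n × n` Toeplitz matrix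
of `φ`. The claim is thus Szegő's theorem for `L²` symbols.

The Toeplitz operator is compared with the circulant of the truncated symbol `p_M = ∑_{|m| ≤ M} a_m
z^m`, which the discrete Fourier transform diagonalises with eigenvalues the values of `p_M` at the
`n`-th roots of unity. Away from `2M` boundary columns per block the two differ only by the tail of
`a`, so the squared Hilbert–Schmidt norm of the difference, divided by the dimension, is at most the
tail of `∑ ‖a_m‖²` plus `O_M(1/n)` (`IsBlockToeplitz.sum_norm_sq_sub_circulant_le`).

A Hoffman–Wielandt argument turns this into closeness of spectra. The squared moduli of the inner
products of two eigenbases form a doubly stochastic matrix, against which the squared eigenvalue or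
singular value differences are bounded by the Hilbert–Schmidt norm. Since `‖G x - G y‖ ≤ ε + C dist
x y ^ 2`, the means of `G` are then close. Means over roots of unity converge to integrals, and `M →
∞` finishes.

The coefficients are controlled by a nowhere vanishing `w`, a multiple of an element of `K_B`: the
functions `w B^m` are orthonormal, which gives existence, uniqueness and square summability of `a`.
-/

lemma sum_norm_sq_apply_eq_adjoint [FiniteDimensional ℂ E] (u : OrthonormalBasis ι ℂ E)
    (v : OrthonormalBasis κ ℂ E) (D : E →ₗ[ℂ] E) :
    ∑ i, ‖D (u i)‖ ^ 2 = ∑ j, ‖D.adjoint (v j)‖ ^ 2 := by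
  calc ∑ i, ‖D (u i)‖ ^ 2 = ∑ i, ∑ j, ‖⟪v j, D (u i)⟫_ℂ‖ ^ 2 :=
        Finset.sum_congr rfl fun i _ => (v.sum_sq_norm_inner_right _).symm
    _ = ∑ j, ∑ i, ‖⟪D.adjoint (v j), u i⟫_ℂ‖ ^ 2 := by
        rw [Finset.sum_comm]
        simp_rw [LinearMap.adjoint_inner_left]
    _ = ∑ j, ‖D.adjoint (v j)‖ ^ 2 :=
        Finset.sum_congr rfl fun j _ => u.sum_sq_norm_inner_left _

/-- The Hilbert–Schmidt norm does not depend on the basis: both sides equal the same sum for the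
adjoint. -/
lemma sum_norm_sq_apply_eq [FiniteDimensional ℂ E] (u : OrthonormalBasis ι ℂ E)
    (v : OrthonormalBasis κ ℂ E) (D : E →ₗ[ℂ] E) :
    ∑ i, ‖D (u i)‖ ^ 2 = ∑ j, ‖D (v j)‖ ^ 2 :=
  (sum_norm_sq_apply_eq_adjoint u v D).trans (sum_norm_sq_apply_eq_adjoint v v D).symm

/-- Comparison of the sums of `G` over two families, through the doubly stochastic matrix
`‖⟪uᵢ, vⱼ⟫‖²` of two orthonormal bases. -/
lemma norm_sum_sub_sum_le {X : Type*} [PseudoMetricSpace X] (u : OrthonormalBasis ι ℂ E)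
    (v : OrthonormalBasis κ ℂ E) (α : ι → X) (β : κ → X) {G : X → ℂ} {ε C R : ℝ} (hC : 0 ≤ C)
    (hG : ∀ x y, ‖G x - G y‖ ≤ ε + C * dist x y ^ 2)
    (hR : ∑ i, ∑ j, dist (α i) (β j) ^ 2 * ‖⟪u i, v j⟫_ℂ‖ ^ 2 ≤ R) :
    ‖∑ i, G (α i) - ∑ j, G (β j)‖ ≤ ε * Fintype.card ι + C * R := by
  have h1 : ∑ i, G (α i) = ∑ i, ∑ j, ((‖⟪u i, v j⟫_ℂ‖ ^ 2 : ℝ) : ℂ) * G (α i) := by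
    refine Finset.sum_congr rfl fun i _ => ?_
    rw [← Finset.sum_mul, ← Complex.ofReal_sum, v.sum_sq_norm_inner_left, u.norm_eq_one]
    simp
  have h2 : ∑ j, G (β j) = ∑ i, ∑ j, ((‖⟪u i, v j⟫_ℂ‖ ^ 2 : ℝ) : ℂ) * G (β j) := by
    rw [Finset.sum_comm]
    refine Finset.sum_congr rfl fun i _ => ?_
    rw [← Finset.sum_mul, ← Complex.ofReal_sum, u.sum_sq_norm_inner_right, v.norm_eq_one]
    simp
  rw [h1, h2, ← Finset.sum_sub_distrib]
  simp_rw [← Finset.sum_sub_distrib, ← mul_sub]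
  calc _ ≤ ∑ i, ∑ j, ‖⟪u i, v j⟫_ℂ‖ ^ 2 * (ε + C * dist (α i) (β j) ^ 2) := by
        refine (norm_sum_le _ _).trans (Finset.sum_le_sum fun i _ => ?_)
        refine (norm_sum_le _ _).trans (Finset.sum_le_sum fun j _ => ?_)
        rw [norm_mul, Complex.norm_real, Real.norm_of_nonneg (by positivity)]
        exact mul_le_mul_of_nonneg_left (hG _ _) (by positivity)
    _ = ε * (∑ i, ∑ j, ‖⟪u i, v j⟫_ℂ‖ ^ 2)
          + C * ∑ i, ∑ j, dist (α i) (β j) ^ 2 * ‖⟪u i, v j⟫_ℂ‖ ^ 2 := by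
        simp_rw [Finset.mul_sum, ← Finset.sum_add_distrib]
        refine Finset.sum_congr rfl fun i _ => Finset.sum_congr rfl fun j _ => ?_
        ring
    _ ≤ _ := by
        have : ∑ i, ∑ j, ‖⟪u i, v j⟫_ℂ‖ ^ 2 = Fintype.card ι := by
          simp [v.sum_sq_norm_inner_left]
        rw [this]
        gcongr

/-- Hoffman–Wielandt identity: letting `T` act on the left vector gives `⟪u i, (T - S) (v j)⟫ = (α i
- β j) ⟪u i, v j⟫`, and Parseval sums over `i`. -/
lemma sum_dist_sq_mul_eq_of_isSymmetric (u : OrthonormalBasis ι ℂ E)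
    (v : OrthonormalBasis κ ℂ E) {T S : E →ₗ[ℂ] E} (hT : T.IsSymmetric) {α : ι → ℝ} {β : κ → ℂ}
    (hu : ∀ i, T (u i) = (α i : ℂ) • u i) (hv : ∀ j, S (v j) = β j • v j) :
    ∑ i, ∑ j, dist (α i : ℂ) (β j) ^ 2 * ‖⟪u i, v j⟫_ℂ‖ ^ 2 = ∑ j, ‖(T - S) (v j)‖ ^ 2 := by
  rw [Finset.sum_comm]
  refine Finset.sum_congr rfl fun j _ => ?_
  rw [← u.sum_sq_norm_inner_right]
  refine Finset.sum_congr rfl fun i _ => ?_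
  rw [LinearMap.sub_apply, inner_sub_right, ← hT, hu, hv, inner_smul_left, inner_smul_right,
    Complex.conj_ofReal, ← sub_mul, norm_mul, mul_pow, dist_eq_norm]

lemma adjoint_apply_of_orthonormalBasis [FiniteDimensional ℂ E] (v : OrthonormalBasis κ ℂ E)
    {S : E →ₗ[ℂ] E} {β : κ → ℂ} (hv : ∀ j, S (v j) = β j • v j) (j : κ) :
    S.adjoint (v j) = conj (β j) • v j := by
  classical
  refine InnerProductSpace.ext_inner_left_basis v.toBasis fun k => ?_
  rw [v.coe_toBasis, LinearMap.adjoint_inner_right, hv, inner_smul_left, inner_smul_right,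
    orthonormal_iff_ite.1 v.orthonormal]
  split_ifs with h
  · rw [h]
  · simp

/-- Bessel's inequality for the normalised vectors. Those with `σ i = 0` contribute nothing, because
`0⁻¹ = 0`. -/
lemma sum_inner_sq_smul_inv_le (u : ι → E) {σ : ι → ℝ}
    (hu : ∀ i k, i ≠ k → ⟪u i, u k⟫_ℂ = 0) (hσ : ∀ i, ‖u i‖ = σ i) (z : E) :
    ∑ i, ‖⟪(σ i : ℂ)⁻¹ • u i, z⟫_ℂ‖ ^ 2 ≤ ‖z‖ ^ 2 := by
  classical
  have hon : Orthonormal ℂ (fun i : {i // σ i ≠ 0} => (σ i : ℂ)⁻¹ • u i) := by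
    refine ⟨fun i => ?_, fun i k hik => ?_⟩
    · rw [norm_smul, hσ, norm_inv, Complex.norm_real, Real.norm_of_nonneg (hσ i ▸ norm_nonneg _),
        inv_mul_cancel₀ i.2]
    · simp only [inner_smul_left, inner_smul_right]
      rw [hu _ _ fun h => hik (Subtype.ext h)]; simp
  calc ∑ i, ‖⟪(σ i : ℂ)⁻¹ • u i, z⟫_ℂ‖ ^ 2
      = ∑ i ∈ Finset.univ.filter (fun i => σ i ≠ 0), ‖⟪(σ i : ℂ)⁻¹ • u i, z⟫_ℂ‖ ^ 2 := by
        rw [Finset.sum_filter_of_ne]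
        intro i _ h h0
        apply h
        simp [h0]
    _ = ∑ i : {i // σ i ≠ 0}, ‖⟪(σ i : ℂ)⁻¹ • u i, z⟫_ℂ‖ ^ 2 :=
        Finset.sum_subtype _ (by simp) _
    _ ≤ ‖z‖ ^ 2 := hon.sum_inner_products_le z

/-- Singular value analogue. With `D = T - S` and `y i = T (u i) / σ i`, one has `(σ² - |β|²) ⟪u, v⟫
= σ ⟪y, D v⟫ + β ⟪D u, v⟫`. Dividing by `σ + |β|` bounds `|σ - |β|| |⟪u, v⟫|` by `|⟪y, D v⟫| + |⟪D
u, v⟫|`. After squaring, Bessel bounds the first family and basis independence the second, each with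
a factor `2`. -/
lemma sum_dist_sq_mul_le_of_adjoint_comp [FiniteDimensional ℂ E] (u : OrthonormalBasis ι ℂ E)
    (v : OrthonormalBasis κ ℂ E) {T S : E →ₗ[ℂ] E} {σ : ι → ℝ} {β : κ → ℂ} (hσ : ∀ i, 0 ≤ σ i)
    (hu : ∀ i, T.adjoint (T (u i)) = ((σ i ^ 2 : ℝ) : ℂ) • u i)
    (hv : ∀ j, S (v j) = β j • v j) :
    ∑ i, ∑ j, dist (σ i) ‖β j‖ ^ 2 * ‖⟪u i, v j⟫_ℂ‖ ^ 2 ≤ 4 * ∑ j, ‖(T - S) (v j)‖ ^ 2 := by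
  classical
  set D := T - S with hD
  have hTT : ∀ i k, ⟪T (u i), T (u k)⟫_ℂ = if i = k then ((σ i ^ 2 : ℝ) : ℂ) else 0 := by
    intro i k
    rw [← LinearMap.adjoint_inner_left, hu, inner_smul_left, Complex.conj_ofReal,
      orthonormal_iff_ite.1 u.orthonormal]
    simp
  have hnorm : ∀ i, ‖T (u i)‖ = σ i := by
    intro i
    have h1 : ‖T (u i)‖ ^ 2 = σ i ^ 2 := by
      have h2 := inner_self_eq_norm_sq_to_K (𝕜 := ℂ) (T (u i))
      rw [hTT, if_pos rfl, ← RCLike.ofReal_pow] at h2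
      exact (Complex.ofReal_inj.1 h2).symm
    exact (pow_left_inj₀ (norm_nonneg _) (hσ i) two_ne_zero).1 h1
  set y : ι → E := fun i => ((σ i : ℂ)⁻¹) • T (u i) with hy
  have hTy : ∀ i, T (u i) = (σ i : ℂ) • y i := by
    intro i
    by_cases h : σ i = 0
    · rw [norm_eq_zero.1 ((hnorm i).trans h), h]; simp
    · rw [hy, smul_smul, mul_inv_cancel₀ (by exact_mod_cast h), one_smul]
  have bessel : ∀ z : E, ∑ i, ‖⟪y i, z⟫_ℂ‖ ^ 2 ≤ ‖z‖ ^ 2 :=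
    sum_inner_sq_smul_inv_le _ (fun i k h => by rw [hTT, if_neg h]) hnorm
  have hpt : ∀ i j, dist (σ i) ‖β j‖ ^ 2 * ‖⟪u i, v j⟫_ℂ‖ ^ 2
      ≤ 2 * ‖⟪y i, D (v j)⟫_ℂ‖ ^ 2 + 2 * ‖⟪D (u i), v j⟫_ℂ‖ ^ 2 := by
    intro i j
    have e2 : (((σ i ^ 2 - ‖β j‖ ^ 2 : ℝ) : ℂ)) * ⟪u i, v j⟫_ℂ =
        (σ i : ℂ) * ⟪y i, D (v j)⟫_ℂ + β j * ⟪D (u i), v j⟫_ℂ := by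
      have e1 : ⟪T (u i), T (v j)⟫_ℂ = ((σ i ^ 2 : ℝ) : ℂ) * ⟪u i, v j⟫_ℂ := by
        rw [← LinearMap.adjoint_inner_left, hu, inner_smul_left, Complex.conj_ofReal]
      have e3 : ⟪S (u i), v j⟫_ℂ = conj (β j) * ⟪u i, v j⟫_ℂ := by
        rw [← LinearMap.adjoint_inner_right, adjoint_apply_of_orthonormalBasis v hv,
          inner_smul_right]
      have e4 : (σ i : ℂ) * ⟪y i, D (v j)⟫_ℂ = ⟪T (u i), D (v j)⟫_ℂ := by
        rw [hTy, inner_smul_left _ _ (σ i : ℂ), Complex.conj_ofReal]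
      rw [e4, hD, LinearMap.sub_apply, LinearMap.sub_apply, hv, inner_sub_right, inner_sub_left,
        inner_smul_right, e1, e3]
      have e5 : ((‖β j‖ ^ 2 : ℝ) : ℂ) = β j * conj (β j) := by
        rw [Complex.mul_conj, Complex.normSq_eq_norm_sq]
      rw [Complex.ofReal_sub, e5]
      ring
    have h := congrArg norm e2
    rw [norm_mul, Complex.norm_real] at h
    have h' := norm_add_le ((σ i : ℂ) * ⟪y i, D (v j)⟫_ℂ) (β j * ⟪D (u i), v j⟫_ℂ)
    rw [← h, norm_mul, norm_mul, Complex.norm_real, Real.norm_of_nonneg (hσ i),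
      sq_sub_sq, norm_mul, Real.norm_of_nonneg (add_nonneg (hσ i) (norm_nonneg (β j)))] at h'
    rw [Real.dist_eq, ← Real.norm_eq_abs]
    generalize hw : ‖⟪u i, v j⟫_ℂ‖ = w at *
    generalize hp : ‖⟪y i, D (v j)⟫_ℂ‖ = p at *
    generalize hq : ‖⟪D (u i), v j⟫_ℂ‖ = q at *
    have hw0 : 0 ≤ w := hw ▸ norm_nonneg _
    have hp0 : 0 ≤ p := hp ▸ norm_nonneg _
    have hq0 : 0 ≤ q := hq ▸ norm_nonneg _
    have hs := hσ i
    have hb := norm_nonneg (β j)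
    rcases (add_nonneg hs hb).eq_or_lt with h0 | h0
    · have a1 : σ i = 0 := by linarith
      have a2 : ‖β j‖ = 0 := by linarith
      rw [a1, a2]
      simp only [sub_zero, norm_zero, ne_eq, OfNat.ofNat_ne_zero, not_false_eq_true, zero_pow,
        zero_mul]
      positivity
    · have h3 : ‖σ i - ‖β j‖‖ * w ≤ p + q := by
        refine le_of_mul_le_mul_left ?_ h0
        nlinarith
      rw [← mul_pow]
      have h4 : 0 ≤ ‖σ i - ‖β j‖‖ * w := by positivity
      nlinarith [sq_nonneg (p - q)]
  calc _ ≤ ∑ i, ∑ j, (2 * ‖⟪y i, D (v j)⟫_ℂ‖ ^ 2 + 2 * ‖⟪D (u i), v j⟫_ℂ‖ ^ 2) :=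
        Finset.sum_le_sum fun i _ => Finset.sum_le_sum fun j _ => hpt i j
    _ = 2 * (∑ j, ∑ i, ‖⟪y i, D (v j)⟫_ℂ‖ ^ 2) + 2 * ∑ i, ‖D (u i)‖ ^ 2 := by
        simp_rw [Finset.sum_add_distrib, ← Finset.mul_sum, v.sum_sq_norm_inner_left]
        rw [Finset.sum_comm]
    _ ≤ 2 * (∑ j, ‖D (v j)‖ ^ 2) + 2 * ∑ j, ‖D (v j)‖ ^ 2 := by
        rw [sum_norm_sq_apply_eq u v]
        gcongr with j
        exact bessel _
    _ = _ := by ring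

/-- Uniform continuity handles distances below `δ`; beyond `δ` the bound `2 |M|` is absorbed by the
quadratic term. The quadratic form is what a Hilbert–Schmidt or `L²` estimate can control. -/
lemma exists_modulus {X : Type*} [PseudoMetricSpace X] {G : X → ℂ} (hG : Continuous G)
    (hc : HasCompactSupport G) {ε : ℝ} (hε : 0 < ε) :
    ∃ C : ℝ, 0 ≤ C ∧ ∀ x y, ‖G x - G y‖ ≤ ε + C * dist x y ^ 2 := by
  obtain ⟨M, hM⟩ := hc.exists_bound_of_continuous hG
  obtain ⟨δ, hδ, h⟩ := Metric.uniformContinuous_iff.1 (hc.uniformContinuous_of_continuous hG) ε hε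
  refine ⟨2 * |M| / δ ^ 2, by positivity, fun x y => ?_⟩
  by_cases hxy : dist x y < δ
  · have := h hxy
    rw [dist_eq_norm] at this
    have : 0 ≤ 2 * |M| / δ ^ 2 * dist x y ^ 2 := by positivity
    linarith
  · push Not at hxy
    have h1 : ‖G x - G y‖ ≤ 2 * |M| := by
      refine (norm_sub_le _ _).trans ?_
      have := hM x; have := hM y; have := le_abs_self M
      linarith
    have h2 : 2 * |M| ≤ 2 * |M| / δ ^ 2 * dist x y ^ 2 := by
      rw [div_mul_eq_mul_div, le_div_iff₀ (by positivity)]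
      gcongr
    linarith

end LinearAlgebra

/-! ### Block circulants and block Toeplitz operators -/

section Circulant

/-- The trigonometric polynomial `∑_{m ∈ s} a_m z^m` on the circle. -/
noncomputable def trigPoly (a : ℤ → ℂ) (s : Finset ℤ) : C(Torus, ℂ) :=
  ∑ m ∈ s, a m • fourier m

lemma trigPoly_apply (a : ℤ → ℂ) (s : Finset ℤ) (t : Torus) :
    trigPoly a s t = ∑ m ∈ s, a m * fourier m t := by
  simp [trigPoly, ContinuousMap.sum_apply]

/-- The `n`-th root of unity `e^{2πik/n}`, as a point of the torus. -/
noncomputable def rootPt (n k : ℕ) : Torus :=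
  ((2 * Real.pi * (k / n) : ℝ) : Torus)

lemma fourier_rootPt (n : ℕ) [NeZero n] (m : ℤ) (k : ZMod n) :
    fourier m (rootPt n k.val) = ZMod.stdAddChar ((m : ZMod n) * k) := by
  have h : (m : ZMod n) * k = ((m * k.val : ℤ) : ZMod n) := by simp
  rw [h, ZMod.stdAddChar_coe, rootPt, fourier_coe_apply]
  congr 1
  have : (Real.pi : ℂ) ≠ 0 := by exact_mod_cast Real.pi_ne_zero
  push_cast
  field_simp

lemma sum_stdAddChar_mul (n : ℕ) [NeZero n] (b : ZMod n) :
    ∑ j : ZMod n, ZMod.stdAddChar (j * b) = if b = 0 then (n : ℂ) else 0 := by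
  rw [AddChar.sum_mulShift b (ZMod.isPrimitive_stdAddChar n), ZMod.card]
  simp

lemma conj_stdAddChar (n : ℕ) [NeZero n] (b : ZMod n) :
    conj (ZMod.stdAddChar b : ℂ) = ZMod.stdAddChar (-b) := by
  rw [ZMod.stdAddChar_apply, ZMod.stdAddChar_apply, AddChar.map_neg_eq_inv, Circle.coe_inv_eq_conj]

variable {n : ℕ} [NeZero n] {E : Type*} [NormedAddCommGroup E] [InnerProductSpace ℂ E]
  {ι : Type*} [Fintype ι]

/-- The block circulant operator with symbol `∑_{m ∈ s} a_m z^m` in an orthonormal basis indexed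
by `ℤ/n × ι`. -/
noncomputable def circulant (x : OrthonormalBasis (ZMod n × ι) ℂ E) (a : ℤ → ℂ) (s : Finset ℤ) :
    E →ₗ[ℂ] E :=
  x.toBasis.constr ℂ fun p => ∑ m ∈ s, a m • x (p.1 + m, p.2)

lemma circulant_apply (x : OrthonormalBasis (ZMod n × ι) ℂ E) (a : ℤ → ℂ) (s : Finset ℤ)
    (p : ZMod n × ι) : circulant x a s (x p) = ∑ m ∈ s, a m • x (p.1 + m, p.2) := by
  rw [circulant, ← x.coe_toBasis, Module.Basis.constr_basis]

/-- The discrete Fourier transform of an orthonormal basis indexed by `ℤ/n × ι`. -/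
noncomputable def dftVec (x : OrthonormalBasis (ZMod n × ι) ℂ E) (p : ZMod n × ι) : E :=
  ((√n : ℝ) : ℂ)⁻¹ • ∑ j : ZMod n, (ZMod.stdAddChar (-(j * p.1)) : ℂ) • x (j, p.2)

lemma circulant_dftVec (x : OrthonormalBasis (ZMod n × ι) ℂ E) (a : ℤ → ℂ) (s : Finset ℤ)
    (p : ZMod n × ι) :
    circulant x a s (dftVec x p) = trigPoly a s (rootPt n p.1.val) • dftVec x p := by
  simp only [dftVec, map_smul, map_sum, circulant_apply]
  rw [smul_comm]
  congr 1
  simp_rw [trigPoly_apply, Finset.sum_smul, Finset.smul_sum]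
  rw [Finset.sum_comm]
  refine Finset.sum_congr rfl fun m _ => ?_
  symm
  -- Translating the index by `m` produces the character value at `m * p.1`, which is the `m`-th
  -- mode at the root of unity.
  rw [← Equiv.sum_comp (Equiv.addRight (m : ZMod n))]
  refine Finset.sum_congr rfl fun j _ => ?_
  simp only [Equiv.coe_addRight, fourier_rootPt, smul_smul]
  congr 1
  rw [mul_assoc, ← AddChar.map_add_eq_mul, mul_comm]
  congr 2
  ring

lemma orthonormal_dftVec (x : OrthonormalBasis (ZMod n × ι) ℂ E) : Orthonormal ℂ (dftVec x) := by
  classical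
  have hn : (n : ℂ) ≠ 0 := by exact_mod_cast NeZero.ne n
  have hsq : ((√n : ℝ) : ℂ)⁻¹ * ((√n : ℝ) : ℂ)⁻¹ = (n : ℂ)⁻¹ := by
    rw [← mul_inv, ← Complex.ofReal_mul, Real.mul_self_sqrt (Nat.cast_nonneg n)]; simp
  rw [orthonormal_iff_ite]
  rintro ⟨k, i⟩ ⟨l, i'⟩
  simp only [dftVec, inner_smul_left, inner_smul_right, sum_inner, inner_sum,
    orthonormal_iff_ite.1 x.orthonormal, Prod.mk.injEq, map_inv₀, Complex.conj_ofReal]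
  by_cases hi : i = i'
  · subst hi
    simp only [and_true, mul_ite, mul_one, mul_zero, Finset.mem_univ, if_true,
      Finset.sum_ite_eq']
    have : ∀ j : ZMod n, (ZMod.stdAddChar (-(j * l)) : ℂ) *
        (((√n : ℝ) : ℂ)⁻¹ * conj (ZMod.stdAddChar (-(j * k)) : ℂ))
        = ((√n : ℝ) : ℂ)⁻¹ * ZMod.stdAddChar (j * (k - l)) := by
      intro j
      rw [conj_stdAddChar, mul_left_comm, ← AddChar.map_add_eq_mul]
      congr 2
      ring
    simp_rw [this, ← Finset.mul_sum, sum_stdAddChar_mul, sub_eq_zero]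
    rw [← mul_assoc, hsq]
    split_ifs <;> simp [hn]
  · simp [hi]

lemma exists_orthonormalBasis_circulant [FiniteDimensional ℂ E]
    (x : OrthonormalBasis (ZMod n × ι) ℂ E) :
    ∃ v : OrthonormalBasis (ZMod n × ι) ℂ E, ∀ a s p,
      circulant x a s (v p) = trigPoly a s (rootPt n p.1.val) • v p := by
  classical
  have hon := orthonormal_dftVec x
  have hcard : Fintype.card (ZMod n × ι) = Module.finrank ℂ E :=
    (Module.finrank_eq_card_basis x.toBasis).symm
  refine ⟨OrthonormalBasis.mk hon
    (hon.linearIndependent.span_eq_top_of_card_eq_finrank' hcard).ge, fun a s p => ?_⟩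
  rw [OrthonormalBasis.coe_mk, circulant_dftVec]

/-- `T` is the block Toeplitz operator `(a_{k-j} δ_{il})` in the basis `x`. -/
def IsBlockToeplitz [DecidableEq ι] (x : OrthonormalBasis (ZMod n × ι) ℂ E) (a : ℤ → ℂ)
    (T : E →ₗ[ℂ] E) : Prop :=
  ∀ p q, ⟪x q, T (x p)⟫_ℂ = if q.2 = p.2 then a ((q.1.val : ℤ) - p.1.val) else 0

/-- A column of a Toeplitz matrix lists distinct terms of the sequence, so its norm is bounded
independently of `n`. -/
lemma sum_norm_sq_translate_le {b : ℤ → ℝ} (hb : Summable b) (h0 : ∀ m, 0 ≤ b m) (j : ZMod n) :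
    ∑ k : ZMod n, b ((k.val : ℤ) - j.val) ≤ ∑' m, b m := by
  have hinj : Function.Injective fun k : ZMod n => (k.val : ℤ) - j.val := by
    intro k l h
    simp only at h
    exact ZMod.val_injective n (by omega)
  have := hb.sum_le_tsum (Finset.univ.map ⟨_, hinj⟩) fun m _ => h0 m
  rwa [Finset.sum_map] at this

variable [DecidableEq ι]

lemma IsBlockToeplitz.norm_sq_apply {x : OrthonormalBasis (ZMod n × ι) ℂ E} {a : ℤ → ℂ}
    {T : E →ₗ[ℂ] E} (hT : IsBlockToeplitz x a T) (p : ZMod n × ι) :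
    ‖T (x p)‖ ^ 2 = ∑ k : ZMod n, ‖a ((k.val : ℤ) - p.1.val)‖ ^ 2 := by
  rw [← x.sum_sq_norm_inner_right, Fintype.sum_prod_type]
  refine Finset.sum_congr rfl fun k _ => ?_
  simp only [hT p]
  rw [Finset.sum_eq_single p.2] <;> simp +contextual

/-- Crude bound, uniform in `n`, for the few columns in which the circulant wraps around. -/
lemma IsBlockToeplitz.norm_sq_sub_circulant_le {x : OrthonormalBasis (ZMod n × ι) ℂ E} {a : ℤ → ℂ}
    (ha : Summable fun m => ‖a m‖ ^ 2) {T : E →ₗ[ℂ] E} (hT : IsBlockToeplitz x a T) (s : Finset ℤ)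
    (p : ZMod n × ι) : ‖(T - circulant x a s) (x p)‖ ^ 2 ≤
      2 * (∑' m, ‖a m‖ ^ 2) + 2 * (∑ m ∈ s, ‖a m‖) ^ 2 := by
  have h1 : ‖T (x p)‖ ^ 2 ≤ ∑' m, ‖a m‖ ^ 2 := by
    rw [hT.norm_sq_apply]
    exact sum_norm_sq_translate_le ha (fun _ => by positivity) _
  have h2 : ‖circulant x a s (x p)‖ ≤ ∑ m ∈ s, ‖a m‖ := by
    rw [circulant_apply]
    refine (norm_sum_le _ _).trans_eq (Finset.sum_congr rfl fun m _ => ?_)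
    rw [norm_smul, x.norm_eq_one, mul_one]
  rw [LinearMap.sub_apply]
  have h3 := norm_sub_le (T (x p)) (circulant x a s (x p))
  have h4 : ‖circulant x a s (x p)‖ ^ 2 ≤ (∑ m ∈ s, ‖a m‖) ^ 2 := by gcongr
  nlinarith [sq_nonneg (‖T (x p)‖ - ‖circulant x a s (x p)‖),
    norm_nonneg (T (x p) - circulant x a s (x p)), norm_nonneg (T (x p)),
    norm_nonneg (circulant x a s (x p))]

/-- Without wrap-around, the circulant column is the Toeplitz column restricted to offsets in `s`,
so only coefficients outside `s` survive in the difference. -/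
lemma IsBlockToeplitz.norm_sq_sub_circulant_le_of_mem {x : OrthonormalBasis (ZMod n × ι) ℂ E}
    {a : ℤ → ℂ} (ha : Summable fun m => ‖a m‖ ^ 2) {T : E →ₗ[ℂ] E} (hT : IsBlockToeplitz x a T)
    (s : Finset ℤ) (p : ZMod n × ι) (hp : ∀ m ∈ s, 0 ≤ (p.1.val : ℤ) + m ∧ p.1.val + m < n) :
    ‖(T - circulant x a s) (x p)‖ ^ 2 ≤ ∑' m, if m ∈ s then 0 else ‖a m‖ ^ 2 := by
  have hval : ∀ m ∈ s, (((p.1 + m : ZMod n).val : ℕ) : ℤ) = p.1.val + m := by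
    intro m hm
    obtain ⟨h1, h2⟩ := hp m hm
    have : (p.1 + m : ZMod n) = (((p.1.val : ℤ) + m : ℤ) : ZMod n) := by simp
    rw [this, ZMod.val_intCast, Int.emod_eq_of_lt h1 h2]
  have hS : ∀ q : ZMod n × ι, ⟪x q, circulant x a s (x p)⟫_ℂ =
      if q.2 = p.2 ∧ (q.1.val : ℤ) - p.1.val ∈ s then a ((q.1.val : ℤ) - p.1.val) else 0 := by
    intro q
    simp only [circulant_apply, inner_sum, inner_smul_right, orthonormal_iff_ite.1 x.orthonormal]
    have : ∀ m ∈ s, (a m * if q = (p.1 + (m : ZMod n), p.2) then (1 : ℂ) else 0) =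
        if m = (q.1.val : ℤ) - p.1.val then (if q.2 = p.2 then a m else 0) else 0 := by
      intro m hm
      have e : q = (p.1 + (m : ZMod n), p.2) ↔ m = (q.1.val : ℤ) - p.1.val ∧ q.2 = p.2 := by
        rw [Prod.ext_iff]
        refine and_congr_left fun _ => ⟨fun h => ?_, fun h => ?_⟩
        · have := hval m hm
          simp only at h
          rw [h]; omega
        · apply ZMod.val_injective n
          have := hval m hm
          simp only
          omega
      simp only [e]
      by_cases h1 : m = (q.1.val : ℤ) - p.1.val <;> by_cases h2 : q.2 = p.2 <;> simp [h1, h2]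
    rw [Finset.sum_congr rfl this, Finset.sum_ite_eq']
    by_cases h1 : (q.1.val : ℤ) - p.1.val ∈ s <;> by_cases h2 : q.2 = p.2 <;> simp [h2]
  have hsum : Summable fun m => if m ∈ s then 0 else ‖a m‖ ^ 2 :=
    ha.of_nonneg_of_le (fun m => by split_ifs <;> positivity)
      fun m => by split_ifs <;> simp
  refine le_trans (le_of_eq ?_) (sum_norm_sq_translate_le hsum
    (fun m => by split_ifs <;> positivity) p.1)
  rw [← x.sum_sq_norm_inner_right, Fintype.sum_prod_type]
  refine Finset.sum_congr rfl fun k _ => ?_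
  simp only [LinearMap.sub_apply, inner_sub_right, hT p, hS]
  rw [Finset.sum_eq_single p.2]
  · split_ifs <;> simp_all
  · intro i _ hi; simp [hi]
  · simp

lemma card_filter_val_lt_le (M : ℕ) :
    (Finset.univ.filter fun j : ZMod n => j.val < M ∨ n ≤ j.val + M).card ≤ 2 * M := by
  rw [Finset.filter_or]
  refine (Finset.card_union_le _ _).trans ?_
  rw [two_mul]
  refine add_le_add ?_ ?_
  · refine (Finset.card_le_card_of_injOn (t := Finset.range M) ZMod.val (fun j hj => by
      simpa using hj) (ZMod.val_injective n).injOn).trans_eq (Finset.card_range M)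
  · refine (Finset.card_le_card_of_injOn (t := Finset.range M) (fun j => n - 1 - j.val)
      (fun j hj => ?_) (fun j hj k hk h => ZMod.val_injective n ?_)).trans_eq (Finset.card_range M)
    · have := ZMod.val_lt j
      simp only [Finset.coe_filter, Finset.mem_univ, true_and, Set.mem_ofPred_eq] at hj
      simp only [Finset.coe_range, Set.mem_Iio]
      omega
    · have h1 := ZMod.val_lt j
      have h2 := ZMod.val_lt k
      simp only at h
      omega

/-- Interior columns contribute the tail of `a`, and at most `2 * M` boundary columns per block the
crude bound. Only the tail term grows with `n`. -/
lemma IsBlockToeplitz.sum_norm_sq_sub_circulant_le {x : OrthonormalBasis (ZMod n × ι) ℂ E}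
    {a : ℤ → ℂ} (ha : Summable fun m => ‖a m‖ ^ 2) {T : E →ₗ[ℂ] E} (hT : IsBlockToeplitz x a T)
    (M : ℕ) :
    ∑ p, ‖(T - circulant x a (Finset.Icc (-M : ℤ) M)) (x p)‖ ^ 2 ≤ Fintype.card ι *
      (n * (∑' m, if m ∈ Finset.Icc (-M : ℤ) M then 0 else ‖a m‖ ^ 2) +
        2 * M * (2 * (∑' m, ‖a m‖ ^ 2) + 2 * (∑ m ∈ Finset.Icc (-M : ℤ) M, ‖a m‖) ^ 2)) := by
  set s := Finset.Icc (-M : ℤ) M with hs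
  set η := ∑' m, if m ∈ s then 0 else ‖a m‖ ^ 2 with hη
  set R := 2 * (∑' m, ‖a m‖ ^ 2) + 2 * (∑ m ∈ s, ‖a m‖) ^ 2 with hR
  have hη0 : 0 ≤ η := tsum_nonneg fun m => by split_ifs <;> positivity
  have hR0 : 0 ≤ R := by
    have : 0 ≤ ∑' m, ‖a m‖ ^ 2 := tsum_nonneg fun m => by positivity
    positivity
  set r : ZMod n → ℝ := fun j => η + if j.val < M ∨ n ≤ j.val + M then R else 0 with hr
  have hpt : ∀ p : ZMod n × ι, ‖(T - circulant x a s) (x p)‖ ^ 2 ≤ r p.1 := by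
    intro p
    simp only [hr]
    split_ifs with h
    · have := hT.norm_sq_sub_circulant_le ha s p
      linarith
    · rw [add_zero]
      refine hT.norm_sq_sub_circulant_le_of_mem ha s p fun m hm => ?_
      rw [hs, Finset.mem_Icc] at hm
      omega
  refine (Finset.sum_le_sum fun p _ => hpt p).trans ?_
  rw [Fintype.sum_prod_type]
  simp only [Finset.sum_const, Finset.card_univ, nsmul_eq_mul]
  rw [← Finset.mul_sum, hr, Finset.sum_add_distrib, ← Finset.sum_filter]
  simp only [Finset.sum_const, Finset.card_univ, nsmul_eq_mul, ZMod.card]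
  have : ((Finset.univ.filter fun j : ZMod n => j.val < M ∨ n ≤ j.val + M).card : ℝ) ≤ 2 * M := by
    exact_mod_cast card_filter_val_lt_le M
  gcongr

end Circulant

/-! ### Means over roots of unity and passage to the limit -/

section Averages

lemma sum_zmod_val (n : ℕ) [NeZero n] (g : ℕ → ℂ) :
    ∑ k : ZMod n, g k.val = ∑ k ∈ Finset.range n, g k := by
  obtain _ | n := n
  · exact absurd rfl (NeZero.ne 0)
  · exact Fin.sum_univ_eq_sum_range g (n + 1)

/-- The mean of `f` over the `n`-th roots of unity. -/
noncomputable def rootAvg (n : ℕ) (f : Torus → ℂ) : ℂ :=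
  (n : ℂ)⁻¹ * ∑ k ∈ Finset.range n, f (rootPt n k)

lemma norm_rootAvg_sub_le (n : ℕ) {f g : Torus → ℂ} {c : ℝ} (hc : 0 ≤ c)
    (h : ∀ t, ‖f t - g t‖ ≤ c) : ‖rootAvg n f - rootAvg n g‖ ≤ c := by
  rw [rootAvg, rootAvg, ← mul_sub, ← Finset.sum_sub_distrib, norm_mul, norm_inv,
    Complex.norm_natCast]
  rcases n.eq_zero_or_pos with rfl | hn
  · simpa using hc
  · rw [inv_mul_le_iff₀ (by exact_mod_cast hn)]
    refine (norm_sum_le _ _).trans ?_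
    calc _ ≤ ∑ k ∈ Finset.range n, c := Finset.sum_le_sum fun k _ => h _
      _ = n * c := by simp

lemma integral_fourier (m : ℤ) : ∫ t, fourier m t ∂arc = if m = 0 then 1 else 0 := by
  have := congrFun (fourierCoeff_fourier (T := 2 * Real.pi) m) 0
  rw [fourierCoeff] at this
  simpa [Pi.single_apply, eq_comm] using this

lemma rootAvg_fourier {n : ℕ} (hn : n ≠ 0) (m : ℤ) :
    rootAvg n (fourier m) = if (n : ℤ) ∣ m then 1 else 0 := by
  have : NeZero n := ⟨hn⟩
  have hn' : (n : ℂ) ≠ 0 := by exact_mod_cast hn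
  rw [rootAvg, ← sum_zmod_val n fun k => fourier m (rootPt n k)]
  simp_rw [fourier_rootPt, mul_comm (m : ZMod n), sum_stdAddChar_mul,
    ZMod.intCast_zmod_eq_zero_iff_dvd]
  split_ifs <;> simp [hn']

/-- Each mode `m` is integrated exactly once `n > |m|`; density of trigonometric polynomials in the
uniform norm gives the rest. -/
lemma tendsto_rootAvg (f : C(Torus, ℂ)) :
    Tendsto (fun n => rootAvg n f) atTop (𝓝 (∫ t, f t ∂arc)) := by
  have hspan : ∀ g ∈ Submodule.span ℂ (Set.range (fourier : ℤ → C(Torus, ℂ))),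
      Tendsto (fun n => rootAvg n g) atTop (𝓝 (∫ t, g t ∂arc)) := by
    intro g hg
    induction hg using Submodule.span_induction with
    | mem g hg =>
      obtain ⟨m, rfl⟩ := hg
      rw [integral_fourier]
      refine tendsto_const_nhds.congr' ?_
      filter_upwards [eventually_gt_atTop m.natAbs] with n hn
      rw [rootAvg_fourier (by omega)]
      refine if_congr ⟨fun h => by simp [h], fun h => ?_⟩ rfl rfl
      exact Int.eq_zero_of_abs_lt_dvd h (by rw [Int.abs_eq_natAbs]; omega)
    | zero => simp [rootAvg]
    | add g h _ _ hg hh =>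
      have e : ∫ t, (g + h) t ∂arc = (∫ t, g t ∂arc) + ∫ t, h t ∂arc :=
        integral_add (g.continuous.integrable_of_hasCompactSupport (.of_compactSpace _))
          (h.continuous.integrable_of_hasCompactSupport (.of_compactSpace _))
      rw [e]
      refine (hg.add hh).congr fun n => ?_
      simp [rootAvg, Finset.sum_add_distrib, mul_add]
    | smul c g _ hg =>
      have e : ∫ t, (c • g) t ∂arc = c * ∫ t, g t ∂arc := integral_const_mul c g
      rw [e]
      refine (hg.const_mul c).congr fun n => ?_
      simp [rootAvg, Finset.mul_sum, mul_left_comm]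
  rw [Metric.tendsto_atTop]
  intro ε hε
  have hmem : f ∈ (Submodule.span ℂ (Set.range (fourier : ℤ → C(Torus, ℂ)))).topologicalClosure := by
    rw [span_fourier_closure_eq_top]; trivial
  obtain ⟨g, hg, hfg⟩ := Metric.mem_closure_iff.1 hmem (ε / 4) (by positivity)
  rw [dist_eq_norm] at hfg
  have hpt : ∀ t, ‖f t - g t‖ ≤ ε / 4 := fun t => ((f - g).norm_coe_le_norm t).trans hfg.le
  obtain ⟨N, hN⟩ := Metric.tendsto_atTop.1 (hspan g hg) (ε / 4) (by positivity)
  refine ⟨N, fun n hn => ?_⟩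
  have h1 := norm_rootAvg_sub_le n (by positivity) hpt
  have h2 := hN n hn
  have h3 : ‖(∫ t, f t ∂arc) - ∫ t, g t ∂arc‖ ≤ ε / 4 := by
    rw [← integral_sub (f.continuous.integrable_of_hasCompactSupport (.of_compactSpace _))
          (g.continuous.integrable_of_hasCompactSupport (.of_compactSpace _))]
    refine (norm_integral_le_of_norm_le_const (C := ε / 4) (.of_forall hpt)).trans_eq ?_
    simp
  rw [dist_eq_norm] at h2 ⊢
  calc ‖rootAvg n f - ∫ t, f t ∂arc‖ = ‖(rootAvg n f - rootAvg n g)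
        + (rootAvg n g - ∫ t, g t ∂arc) - ((∫ t, f t ∂arc) - ∫ t, g t ∂arc)‖ := by
          congr 1; ring
    _ ≤ ε / 4 + ε / 4 + ε / 4 := by
        refine (norm_sub_le _ _).trans (add_le_add ((norm_add_le _ _).trans ?_) h3)
        gcongr
    _ < ε := by linarith

lemma integral_norm_sq_eq (f : L2) : ∫ t, ‖f t‖ ^ 2 ∂arc = ‖f‖ ^ 2 := by
  have h := inner_self_eq_norm_sq_to_K (𝕜 := ℂ) f
  rw [L2.inner_def] at h
  simp_rw [inner_self_eq_norm_sq_to_K] at h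
  have h' : ((∫ t, ‖f t‖ ^ 2 ∂arc : ℝ) : ℂ) = ((‖f‖ ^ 2 : ℝ) : ℂ) := by
    refine (integral_ofReal (𝕜 := ℂ)).symm.trans ?_
    simpa using h
  exact Complex.ofReal_inj.1 h'

variable {X : Type*} [PseudoMetricSpace X]

/-- The quadratic modulus integrates to the squared `L²` distance. The map `r` is to be `norm` for
singular values and `id` for eigenvalues. -/
lemma norm_integral_comp_sub_le {G : X → ℂ} (hG : Continuous G)
    (hc : HasCompactSupport G) {r : ℂ → X} (hr : LipschitzWith 1 r) {ε C : ℝ} (hC : 0 ≤ C)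
    (h : ∀ x y, ‖G x - G y‖ ≤ ε + C * dist x y ^ 2) (f g : L2) :
    ‖(∫ t, G (r (f t)) ∂arc) - ∫ t, G (r (g t)) ∂arc‖ ≤ ε + C * ‖f - g‖ ^ 2 := by
  obtain ⟨B, hB⟩ := hc.exists_bound_of_continuous hG
  have hint : ∀ f : L2, Integrable (fun t => G (r (f t))) arc := fun f =>
    Integrable.of_bound ((hG.comp hr.continuous).comp_aestronglyMeasurable
      (Lp.aestronglyMeasurable f)) B (.of_forall fun t => hB _)
  have hsq : Integrable (fun t => ‖(f - g) t‖ ^ 2) arc :=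
    (Lp.memLp (f - g)).integrable_norm_pow (by norm_num)
  rw [← integral_sub (hint f) (hint g)]
  calc _ ≤ ∫ t, (ε + C * ‖(f - g) t‖ ^ 2) ∂arc := by
        refine norm_integral_le_of_norm_le ((integrable_const _).add (hsq.const_mul _)) ?_
        filter_upwards [Lp.coeFn_sub f g] with t ht
        refine (h _ _).trans ?_
        rw [ht, Pi.sub_apply, ← dist_eq_norm]
        have := hr.dist_le_mul (f t) (g t)
        rw [NNReal.coe_one, one_mul] at this
        gcongr
    _ = ε + C * ‖f - g‖ ^ 2 := by
        rw [integral_add (integrable_const _) (hsq.const_mul _), integral_const_mul,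
          integral_norm_sq_eq]
        simp

lemma toLp_trigPoly (a : ℤ → ℂ) (s : Finset ℤ) :
    ContinuousMap.toLp 2 arc ℂ (trigPoly a s) = ∑ m ∈ s, a m • (fourierLp 2 m : L2) := by
  simp [trigPoly, map_sum, map_smul]

lemma tendsto_tsum_off_Icc {b : ℤ → ℝ} (hb : Summable b) :
    Tendsto (fun M : ℕ => ∑' m, if m ∈ Finset.Icc (-M : ℤ) M then 0 else b m) atTop (𝓝 0) := by
  have h1 := hb.hasSum.comp (Finset.tendsto_Icc_neg (R := ℤ))
  have h2 := (tendsto_const_nhds (x := ∑' m, b m)).sub h1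
  rw [sub_self] at h2
  refine h2.congr fun M => ?_
  have h3 : HasSum (fun m => if m ∈ Finset.Icc (-M : ℤ) M then b m else 0)
      (∑ m ∈ Finset.Icc (-M : ℤ) M, b m) := by
    rw [← Finset.sum_congr rfl fun m hm => if_pos hm]
    exact hasSum_sum_of_ne_finset_zero fun m hm => if_neg hm
  rw [Function.comp_apply, ← (hb.hasSum.sub h3).tsum_eq]
  refine tsum_congr fun m => ?_
  split_ifs <;> simp

/-- If `A n` is close to the mean of `G ∘ r` over the values of the trigonometric polynomial
approximations of `φ` at the `n`-th roots of unity, then `A n` tends to the integral of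
`G ∘ r ∘ φ`. -/
lemma tendsto_integral_of_norm_sub_rootAvg_le {G : X → ℂ} (hG : Continuous G)
    (hc : HasCompactSupport G) {r : ℂ → X} (hr : LipschitzWith 1 r) {a : ℤ → ℂ}
    (ha : Summable fun m => ‖a m‖ ^ 2) {φ : L2}
    (hφ : HasSum (fun m => a m • (fourierLp 2 m : L2)) φ) {A : ℕ → ℂ}
    (hA : ∀ M : ℕ, ∃ R : ℝ, ∀ ε C : ℝ, 0 ≤ C → (∀ x y, ‖G x - G y‖ ≤ ε + C * dist x y ^ 2) →
      ∀ n ≠ 0, ‖A n - rootAvg n fun t => G (r (trigPoly a (Finset.Icc (-M : ℤ) M) t))‖ ≤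
        ε + C * (4 * (∑' m, if m ∈ Finset.Icc (-M : ℤ) M then 0 else ‖a m‖ ^ 2) + R / n)) :
    Tendsto A atTop (𝓝 (∫ t, G (r (φ t)) ∂arc)) := by
  rw [Metric.tendsto_atTop]
  intro δ hδ
  -- Order of choices: `C` depends on `δ`, then `M` on `C`, then `N` on `M` and `R`. The final
  -- estimate adds six terms of size at most `δ / 8`.
  obtain ⟨C, hC, hmod⟩ := exists_modulus hG hc (ε := δ / 8) (by positivity)
  have e1 : ∀ᶠ M : ℕ in atTop,
      C * (4 * ∑' m, if m ∈ Finset.Icc (-M : ℤ) M then 0 else ‖a m‖ ^ 2) < δ / 8 := by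
    have := ((tendsto_tsum_off_Icc ha).const_mul 4).const_mul C
    rw [mul_zero, mul_zero] at this
    exact this.eventually_lt_const (by positivity)
  have e2 : ∀ᶠ M : ℕ in atTop,
      C * ‖ContinuousMap.toLp 2 arc ℂ (trigPoly a (Finset.Icc (-M : ℤ) M)) - φ‖ ^ 2 < δ / 8 := by
    have h1 := hφ.comp (Finset.tendsto_Icc_neg (R := ℤ))
    have h2 : Tendsto (fun M : ℕ => C *
        ‖ContinuousMap.toLp 2 arc ℂ (trigPoly a (Finset.Icc (-M : ℤ) M)) - φ‖ ^ 2) atTop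
        (𝓝 (C * ‖φ - φ‖ ^ 2)) := by
      simp_rw [toLp_trigPoly]
      exact (((h1.sub_const φ).norm).pow 2).const_mul C
    refine h2.eventually_lt_const ?_
    simpa using hδ
  obtain ⟨M, hM1, hM2⟩ := (e1.and e2).exists
  obtain ⟨R, hR⟩ := hA M
  set p := trigPoly a (Finset.Icc (-M : ℤ) M) with hp
  have e3 : ∀ᶠ n : ℕ in atTop, C * (R / n) < δ / 8 := by
    have := (tendsto_const_div_atTop_nhds_zero_nat R).const_mul C
    rw [mul_zero] at this
    exact this.eventually_lt_const (by positivity)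
  have hcont : Continuous fun t => G (r (p t)) := hG.comp (hr.continuous.comp p.continuous)
  have e4 := (Metric.tendsto_nhds.1 (tendsto_rootAvg ⟨_, hcont⟩)) (δ / 8) (by positivity)
  obtain ⟨N, hN⟩ := eventually_atTop.1 ((e3.and e4).and (eventually_ne_atTop 0))
  refine ⟨N, fun n hn => ?_⟩
  obtain ⟨⟨h3, h4⟩, h5⟩ := hN n hn
  have h6 := hR _ C hC hmod n h5
  have h7 := norm_integral_comp_sub_le hG hc hr hC hmod (ContinuousMap.toLp 2 arc ℂ p) φ
  have h8 : ∫ t, G (r (ContinuousMap.toLp 2 arc ℂ p t)) ∂arc = ∫ t, G (r (p t)) ∂arc := by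
    refine integral_congr_ae ?_
    filter_upwards [ContinuousMap.coeFn_toLp (p := 2) (𝕜 := ℂ) arc p] with t ht
    rw [ht]
  rw [h8] at h7
  rw [dist_eq_norm] at h4 ⊢
  simp only [ContinuousMap.coe_mk] at h4
  calc _ = ‖(A n - rootAvg n fun t => G (r (p t))) + ((rootAvg n fun t => G (r (p t))) -
        ∫ t, G (r (p t)) ∂arc) + ((∫ t, G (r (p t)) ∂arc) - ∫ t, G (r (φ t)) ∂arc)‖ := by
        congr 1; ring
    _ ≤ _ := norm_add₃_le
    _ < δ := by
        rw [mul_add] at h6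
        linarith

end Averages

/-! ### Spectral means of block Toeplitz operators -/

section BlockToeplitz

variable {n : ℕ} [NeZero n] {E : Type*} [NormedAddCommGroup E] [InnerProductSpace ℂ E]
  {ι : Type*} [Fintype ι]

lemma sum_rootPt_eq (f : Torus → ℂ) :
    ∑ p : ZMod n × ι, f (rootPt n p.1.val) = n * Fintype.card ι * rootAvg n f := by
  have hn : (n : ℂ) ≠ 0 := by exact_mod_cast NeZero.ne n
  rw [Fintype.sum_prod_type, rootAvg, ← sum_zmod_val n fun k => f (rootPt n k)]
  simp only [Finset.sum_const, Finset.card_univ, nsmul_eq_mul]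
  rw [← Finset.mul_sum]
  field_simp

variable [DecidableEq ι]

/-- Normalisation step common to eigenvalues and singular values: dividing by the dimension `n *
card ι` leaves the tail of `a` and a boundary term of order `1 / n`. -/
lemma IsBlockToeplitz.norm_mean_sub_rootAvg_le [Nonempty ι] {x : OrthonormalBasis (ZMod n × ι) ℂ E}
    {a : ℤ → ℂ} (ha : Summable fun m => ‖a m‖ ^ 2) {T : E →ₗ[ℂ] E} (hT : IsBlockToeplitz x a T)
    (M : ℕ) {f : Torus → ℂ} {s : ℂ} {ε C : ℝ} (hC : 0 ≤ C)
    (h : ‖s - ∑ p : ZMod n × ι, f (rootPt n p.1.val)‖ ≤ ε * Module.finrank ℂ E +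
      C * (4 * ∑ p, ‖(T - circulant x a (Finset.Icc (-M : ℤ) M)) (x p)‖ ^ 2)) :
    ‖(Module.finrank ℂ E : ℂ)⁻¹ * s - rootAvg n f‖ ≤
      ε + C * (4 * (∑' m, if m ∈ Finset.Icc (-M : ℤ) M then 0 else ‖a m‖ ^ 2) +
        (4 * (2 * M * (2 * (∑' m, ‖a m‖ ^ 2) +
          2 * (∑ m ∈ Finset.Icc (-M : ℤ) M, ‖a m‖) ^ 2))) / n) := by
  have hcard : Module.finrank ℂ E = n * Fintype.card ι := by
    rw [Module.finrank_eq_card_basis x.toBasis, Fintype.card_prod, ZMod.card]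
  have hn : (0 : ℝ) < n := by exact_mod_cast Nat.pos_of_ne_zero (NeZero.ne n)
  have hd : (0 : ℝ) < Fintype.card ι := by exact_mod_cast Fintype.card_pos
  have hnd : (0 : ℝ) < n * Fintype.card ι := by positivity
  have hnd' : ((n : ℂ) * Fintype.card ι) ≠ 0 := by exact_mod_cast hnd.ne'
  have hS := hT.sum_norm_sq_sub_circulant_le ha M
  rw [sum_rootPt_eq, hcard] at h
  have e : ((n * Fintype.card ι : ℕ) : ℂ)⁻¹ * s - rootAvg n f =
      ((n : ℂ) * Fintype.card ι)⁻¹ * (s - n * Fintype.card ι * rootAvg n f) := by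
    rw [mul_sub, inv_mul_cancel_left₀ hnd', Nat.cast_mul]
  rw [hcard, e, norm_mul, norm_inv, norm_mul, Complex.norm_natCast, Complex.norm_natCast,
    inv_mul_le_iff₀ hnd]
  refine h.trans ?_
  refine (add_le_add_right (mul_le_mul_of_nonneg_left (mul_le_mul_of_nonneg_left hS
    (by norm_num)) hC) _).trans_eq ?_
  push_cast
  field_simp

variable [FiniteDimensional ℂ E]

lemma IsBlockToeplitz.norm_mean_roots_sub_rootAvg_le [Nonempty ι]
    {x : OrthonormalBasis (ZMod n × ι) ℂ E}
    {a : ℤ → ℂ} (ha : Summable fun m => ‖a m‖ ^ 2) {T : E →ₗ[ℂ] E} (hT : IsBlockToeplitz x a T)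
    (hsymm : T.IsSymmetric) (M : ℕ) {G : ℂ → ℂ} {ε C : ℝ} (hC : 0 ≤ C)
    (hG : ∀ x y, ‖G x - G y‖ ≤ ε + C * dist x y ^ 2) :
    ‖(Module.finrank ℂ E : ℂ)⁻¹ * (T.charpoly.roots.map G).sum -
        rootAvg n fun t => G (trigPoly a (Finset.Icc (-M : ℤ) M) t)‖ ≤
      ε + C * (4 * (∑' m, if m ∈ Finset.Icc (-M : ℤ) M then 0 else ‖a m‖ ^ 2) +
        (4 * (2 * M * (2 * (∑' m, ‖a m‖ ^ 2) +
          2 * (∑ m ∈ Finset.Icc (-M : ℤ) M, ‖a m‖) ^ 2))) / n) := by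
  refine hT.norm_mean_sub_rootAvg_le ha M hC ?_
  obtain ⟨v, hv⟩ := exists_orthonormalBasis_circulant x
  have h1 : (T.charpoly.roots.map G).sum = ∑ i, G (hsymm.eigenvalues rfl i) := by
    rw [hsymm.roots_charpoly_eq_eigenvalues rfl, Multiset.map_map]
    rfl
  have h2 := norm_sum_sub_sum_le (G := G) (hsymm.eigenvectorBasis rfl) v
    (fun i => (hsymm.eigenvalues rfl i : ℂ))
    (fun p => trigPoly a (Finset.Icc (-M : ℤ) M) (rootPt n p.1.val)) hC hG
    (sum_dist_sq_mul_eq_of_isSymmetric (hsymm.eigenvectorBasis rfl) v hsymm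
      (hsymm.apply_eigenvectorBasis rfl) (hv a (Finset.Icc (-M : ℤ) M))).le
  rw [Fintype.card_fin, sum_norm_sq_apply_eq v x] at h2
  rw [h1]
  refine h2.trans ?_
  gcongr
  -- In the symmetric case the constant is `1`; it is weakened to the `4` needed for singular
  -- values.
  have : 0 ≤ ∑ p, ‖(T - circulant x a (Finset.Icc (-M : ℤ) M)) (x p)‖ ^ 2 := by positivity
  linarith

lemma IsBlockToeplitz.norm_mean_singularValues_sub_rootAvg_le [Nonempty ι]
    {x : OrthonormalBasis (ZMod n × ι) ℂ E}
    {a : ℤ → ℂ} (ha : Summable fun m => ‖a m‖ ^ 2) {T : E →ₗ[ℂ] E} (hT : IsBlockToeplitz x a T)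
    (M : ℕ) {G : ℝ → ℂ} {ε C : ℝ} (hC : 0 ≤ C)
    (hG : ∀ x y, ‖G x - G y‖ ≤ ε + C * dist x y ^ 2) :
    ‖(Module.finrank ℂ E : ℂ)⁻¹ * (∑ k ∈ Finset.range (Module.finrank ℂ E),
          G (T.singularValues k)) -
        rootAvg n fun t => G ‖trigPoly a (Finset.Icc (-M : ℤ) M) t‖‖ ≤
      ε + C * (4 * (∑' m, if m ∈ Finset.Icc (-M : ℤ) M then 0 else ‖a m‖ ^ 2) +
        (4 * (2 * M * (2 * (∑' m, ‖a m‖ ^ 2) +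
          2 * (∑ m ∈ Finset.Icc (-M : ℤ) M, ‖a m‖) ^ 2))) / n) := by
  refine hT.norm_mean_sub_rootAvg_le ha M hC ?_
  obtain ⟨v, hv⟩ := exists_orthonormalBasis_circulant x
  have hsymm := T.isSymmetric_adjoint_comp_self
  have h2 := norm_sum_sub_sum_le (G := G) (hsymm.eigenvectorBasis rfl) v
    (fun i => T.singularValues i)
    (fun p => ‖trigPoly a (Finset.Icc (-M : ℤ) M) (rootPt n p.1.val)‖) hC hG
    (sum_dist_sq_mul_le_of_adjoint_comp (hsymm.eigenvectorBasis rfl) v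
      (fun i => T.singularValues_nonneg i) (fun i => by
        rw [T.sq_singularValues_fin rfl]
        exact hsymm.apply_eigenvectorBasis rfl i) (hv a (Finset.Icc (-M : ℤ) M)))
  rw [Fintype.card_fin, sum_norm_sq_apply_eq v x] at h2
  rwa [Finset.sum_range]

end BlockToeplitz

/-! ### Orthonormal series -/

section OrthonormalSeries

variable {E : Type*} [NormedAddCommGroup E] [InnerProductSpace ℂ E] [CompleteSpace E]
  {ι : Type*} {v : ι → E}

lemma Orthonormal.summable_smul (hv : Orthonormal ℂ v) {a : ι → ℂ}
    (ha : Summable fun i => ‖a i‖ ^ 2) : Summable fun i => a i • v i := by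
  simpa using (hv.orthogonalFamily.summable_iff_norm_sq_summable a).2 ha

omit [CompleteSpace E] in
lemma Orthonormal.inner_eq_of_hasSum (hv : Orthonormal ℂ v) {a : ι → ℂ} {x : E}
    (h : HasSum (fun i => a i • v i) x) (i : ι) : ⟪v i, x⟫_ℂ = a i := by
  classical
  have h1 := h.mapL (innerSL ℂ (v i))
  have h2 : HasSum (fun k => innerSL ℂ (v i) (a k • v k)) (a i) := by
    have : (fun k => innerSL ℂ (v i) (a k • v k)) = fun k => if k = i then a i else 0 := by
      funext k
      rw [innerSL_apply_apply, inner_smul_right, orthonormal_iff_ite.1 hv]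
      by_cases hk : k = i
      · simp [hk]
      · simp [hk, Ne.symm hk]
    rw [this]
    exact hasSum_ite_eq i (a i)
  exact h1.unique h2

/-- The difference between `x` and its Fourier sum lies in the closed span and is orthogonal to it.
-/
lemma Orthonormal.hasSum_of_mem_closure_span (hv : Orthonormal ℂ v) {x : E}
    (hx : x ∈ (Submodule.span ℂ (Set.range v)).topologicalClosure) :
    HasSum (fun i => ⟪v i, x⟫_ℂ • v i) x := by
  have hs := (hv.summable_smul (Orthonormal.inner_products_summable x hv)
    (a := fun i => ⟪v i, x⟫_ℂ)).hasSum
  set S := ∑' i, ⟪v i, x⟫_ℂ • v i with hS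
  have hSmem : S ∈ (Submodule.span ℂ (Set.range v)).topologicalClosure := by
    refine (Submodule.isClosed_topologicalClosure _).mem_of_tendsto hs (.of_forall fun s => ?_)
    exact Submodule.sum_mem _ fun i _ => Submodule.smul_mem _ _
      (Submodule.le_topologicalClosure _ (Submodule.subset_span ⟨i, rfl⟩))
  have horth : x - S ∈ (Submodule.span ℂ (Set.range v)).topologicalClosureᗮ := by
    rw [Submodule.orthogonal_closure, Submodule.mem_orthogonal]
    intro u hu
    induction hu using Submodule.span_induction with
    | mem u hu =>
      obtain ⟨i, rfl⟩ := hu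
      rw [inner_sub_right, hv.inner_eq_of_hasSum hs, sub_self]
    | zero => simp
    | add u w _ _ hu hw => rw [inner_add_left, hu, hw, add_zero]
    | smul c u _ hu => rw [inner_smul_left, hu, mul_zero]
  have h0 : x - S = 0 := by
    have := Submodule.inner_right_of_mem_orthogonal (Submodule.sub_mem _ hx hSmem) horth
    exact inner_self_eq_zero.1 this
  rwa [← sub_eq_zero.1 h0] at hs

end OrthonormalSeries

/-! ### Multiplication by continuous functions -/

section Multiplication

/-- Multiplication of `L²` functions by continuous functions on the circle. -/
noncomputable def mulCLM : C(Torus, ℂ) →L[ℂ] L2 →L[ℂ] L2 :=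
  ((ContinuousLinearMap.mul ℂ ℂ).holderL arc ∞ 2 2).comp (ContinuousMap.toLp ∞ arc ℂ)

lemma mulCLM_ae (g : C(Torus, ℂ)) (f : L2) : mulCLM g f =ᵐ[arc] fun t => g t * f t := by
  filter_upwards [ContinuousLinearMap.coeFn_holder (ContinuousLinearMap.mul ℂ ℂ) (r := 2)
    (ContinuousMap.toLp ∞ arc ℂ g) f, ContinuousMap.coeFn_toLp (p := ∞) (𝕜 := ℂ) arc g] with t h1 h2
  rw [← h2]
  exact h1

lemma mulCLM_mulCLM (g h : C(Torus, ℂ)) (f : L2) : mulCLM g (mulCLM h f) = mulCLM (g * h) f := by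
  apply Lp.ext
  filter_upwards [mulCLM_ae g (mulCLM h f), mulCLM_ae h f, mulCLM_ae (g * h) f] with t h1 h2 h3
  rw [h1, h2, h3, ContinuousMap.mul_apply, mul_assoc]

lemma mulCLM_one (f : L2) : mulCLM 1 f = f := by
  apply Lp.ext
  filter_upwards [mulCLM_ae 1 f] with t h1
  simp [h1]

lemma mulCLM_toLp (g h : C(Torus, ℂ)) :
    mulCLM g (ContinuousMap.toLp 2 arc ℂ h) = ContinuousMap.toLp 2 arc ℂ (g * h) := by
  apply Lp.ext
  filter_upwards [mulCLM_ae g (ContinuousMap.toLp 2 arc ℂ h),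
    ContinuousMap.coeFn_toLp (p := 2) (𝕜 := ℂ) arc h,
    ContinuousMap.coeFn_toLp (p := 2) (𝕜 := ℂ) arc (g * h)] with t h1 h2 h3
  rw [h1, h2, h3, ContinuousMap.mul_apply]

lemma inner_mulCLM_left (g : C(Torus, ℂ)) (f h : L2) :
    ⟪mulCLM g f, h⟫_ℂ = ⟪f, mulCLM (star g) h⟫_ℂ := by
  rw [L2.inner_def, L2.inner_def]
  refine integral_congr_ae ?_
  filter_upwards [mulCLM_ae g f, mulCLM_ae (star g) h] with t h1 h2
  rw [h1, h2, RCLike.inner_apply, RCLike.inner_apply, map_mul, ContinuousMap.star_apply,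
    starRingEnd_apply]
  ring

lemma polyMul_eq_mulCLM (P : Polynomial ℂ) (f : L2) :
    polyMul P f = mulCLM ⟨_, continuous_eval P⟩ f := by
  apply Lp.ext
  filter_upwards [polyMul_ae P f, mulCLM_ae ⟨_, continuous_eval P⟩ f] with t h1 h2
  rw [h1, h2, mul_comm]; rfl

lemma polyMul_mul (P Q : Polynomial ℂ) (f : L2) : polyMul (P * Q) f = polyMul P (polyMul Q f) := by
  simp only [polyMul_eq_mulCLM, mulCLM_mulCLM]
  congr 2
  ext t
  simp

end Multiplication

/-! ### Orthogonal decomposition of the model spaces -/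

section Hardy

lemma norm_fourierCoeff_le (f : L2) (k : ℤ) : ‖fourierCoeff f k‖ ≤ ‖f‖ := by
  rw [fourierCoeff_eq_repr, HilbertBasis.repr_apply_apply]
  refine (norm_inner_le_norm _ _).trans_eq ?_
  rw [fourierBasis.orthonormal.1, one_mul]

/-- Negative coefficients satisfy `f_k = c f_{k-1}`, hence `f_k = c^m f_{k-m}` for all `m`; they are
bounded by `‖f‖` and `‖c‖ < 1`, so they vanish. -/
lemma mem_hardy_of_polyMul_linear {c : ℂ} (hc : ‖c‖ < 1) {f : L2}
    (hf : polyMul (1 - Polynomial.C c * Polynomial.X) f ∈ hardy) : f ∈ hardy := by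
  have hrec : ∀ k : ℤ, k < 0 → fourierCoeff f k = c * fourierCoeff f (k - 1) := by
    intro k hk
    have h := hf k hk
    rw [fourierCoeff_polyMul, Finset.sum_subset (s₂ := Finset.range 2)] at h
    · simp only [Finset.sum_range_succ, Finset.range_zero, Finset.sum_empty, zero_add] at h
      simp [Polynomial.coeff_one] at h
      linear_combination h
    · intro j hj
      rw [Polynomial.mem_support_iff] at hj
      rw [Finset.mem_range]
      by_contra! hj2
      obtain ⟨j, rfl⟩ := Nat.exists_eq_add_of_le hj2
      apply hj
      simp [Polynomial.coeff_one, Polynomial.coeff_X]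
      omega
    · intro j _ hj
      rw [Polynomial.notMem_support_iff.1 hj, zero_mul]
  intro k hk
  have hpow : ∀ m : ℕ, fourierCoeff f k = c ^ m * fourierCoeff f (k - m) := by
    intro m
    induction m with
    | zero => simp
    | succ m ih =>
      rw [ih, hrec (k - m) (by omega), pow_succ, mul_assoc]
      congr 3
      push_cast
      ring
  have hle : ∀ m : ℕ, ‖fourierCoeff f k‖ ≤ ‖c‖ ^ m * ‖f‖ := by
    intro m
    rw [hpow m, norm_mul, norm_pow]
    gcongr
    exact norm_fourierCoeff_le _ _
  have hlim : Tendsto (fun m : ℕ => ‖c‖ ^ m * ‖f‖) atTop (𝓝 (0 * ‖f‖)) :=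
    (tendsto_pow_atTop_nhds_zero_of_lt_one (norm_nonneg _) hc).mul_const _
  rw [zero_mul] at hlim
  exact norm_le_zero_iff.1 (ge_of_tendsto' hlim hle)

variable {d : ℕ} (lam : Fin d → 𝔻)

lemma mem_hardy_of_polyMul_denPoly (n : ℕ) {f : L2} (hf : polyMul (denPoly lam n) f ∈ hardy) :
    f ∈ hardy := by
  -- Divisibility within `H²` by a polynomial is multiplicative, so the linear factors suffice.
  let D : Polynomial ℂ → Prop := fun P => ∀ f : L2, polyMul P f ∈ hardy → f ∈ hardy
  have hmul : ∀ P Q, D P → D Q → D (P * Q) := by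
    intro P Q hP hQ f h
    rw [polyMul_mul] at h
    exact hQ _ (hP _ h)
  have hone : D 1 := by
    intro f h
    convert h
    rw [polyMul_eq_mulCLM]
    refine (mulCLM_one f).symm.trans ?_
    congr 2
    ext t
    simp
  have hpow : ∀ P, D P → ∀ n : ℕ, D (P ^ n) := by
    intro P hP n
    induction n with
    | zero => simpa using hone
    | succ n ih => rw [pow_succ]; exact hmul _ _ ih hP
  refine Finset.prod_induction _ D hmul hone (fun i _ => hpow _ (fun f h => ?_) n) f hf
  refine mem_hardy_of_polyMul_linear ?_ h
  rw [RCLike.norm_conj]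
  exact (lam i).norm_lt_one

lemma norm_blaschkePow_one (t : Torus) : ‖blaschkePow lam 1 t‖ = 1 := by
  have h1 := congrArg norm (conj_num_mul lam 1 t)
  have h2 := congrArg norm (blaschkePow_mul_den lam 1 t)
  rw [norm_mul, RCLike.norm_conj, norm_pow, norm_pt, one_pow, mul_one] at h1
  rw [norm_mul, h1] at h2
  exact mul_right_cancel₀ (norm_ne_zero_iff.2 (denPoly_ne_zero lam 1 t)) (by simpa using h2)

lemma blaschkePow_apply (m : ℤ) (t : Torus) : blaschkePow lam m t = blaschke lam (pt t) ^ m := rfl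

lemma blaschkePow_add (m k : ℤ) : blaschkePow lam (m + k) = blaschkePow lam m * blaschkePow lam k := by
  ext t
  rw [ContinuousMap.mul_apply]
  exact zpow_add₀ (blaschke_ne_zero lam t) m k

lemma blaschkePow_zero : blaschkePow lam 0 = 1 := by
  ext t
  simp [blaschkePow_apply]

lemma star_blaschkePow (m : ℤ) : star (blaschkePow lam m) = blaschkePow lam (-m) := by
  ext t
  have h : ‖blaschke lam (pt t)‖ = 1 := by simpa [blaschkePow_apply] using norm_blaschkePow_one lam t
  rw [ContinuousMap.star_apply, blaschkePow_apply, blaschkePow_apply, star_zpow₀, zpow_neg,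
    ← inv_zpow]
  congr 1
  exact (Complex.inv_eq_conj h).symm

lemma mulCLM_blaschkePow_add (m k : ℤ) (f : L2) :
    mulCLM (blaschkePow lam m) (mulCLM (blaschkePow lam k) f) = mulCLM (blaschkePow lam (m + k)) f := by
  rw [mulCLM_mulCLM, blaschkePow_add]

/-- Multiplying `Bⁿ f` by the denominator of `Bⁿ` gives numerator times `f`, which is in `H²`; the
denominator can then be divided out. -/
lemma mulCLM_blaschkePow_mem_hardy (n : ℕ) {f : L2} (hf : f ∈ hardy) :
    mulCLM (blaschkePow lam n) f ∈ hardy := by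
  refine mem_hardy_of_polyMul_denPoly lam n ?_
  convert polyMul_mem_hardy (numPoly lam n) hf using 1
  rw [polyMul_eq_mulCLM, polyMul_eq_mulCLM, mulCLM_mulCLM]
  congr 2
  ext t
  rw [ContinuousMap.mul_apply, mul_comm]
  exact blaschkePow_mul_den lam n t

lemma mem_mulHardy_blaschkePow {n : ℤ} {u : L2} :
    u ∈ mulHardy (blaschkePow lam n) ↔ ∃ g ∈ hardy, u = mulCLM (blaschkePow lam n) g := by
  refine exists_congr fun g => and_congr_right fun _ => ⟨fun h => Lp.ext ?_, fun h => ?_⟩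
  · exact h.trans (mulCLM_ae _ _).symm
  · rw [h]; exact mulCLM_ae _ _

/-- Since `m - 1 ≥ 0`, `B^m e = B (B^{m-1} e)` belongs to `B H²`, the space `K_B` is orthogonal to.
-/
lemma inner_mulCLM_blaschkePow_eq_zero {e e' : L2} (he : e ∈ hardy)
    (he' : e' ∈ blaschkeModel lam 1) {m : ℤ} (hm : 0 < m) :
    ⟪mulCLM (blaschkePow lam m) e, e'⟫_ℂ = 0 := by
  refine (Submodule.mem_orthogonal _ _).1 he'.2 _ ((mem_mulHardy_blaschkePow lam).2
    ⟨mulCLM (blaschkePow lam (m - 1).toNat) e, mulCLM_blaschkePow_mem_hardy lam _ he, ?_⟩)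
  rw [mulCLM_blaschkePow_add]
  congr 3
  simp only [Nat.cast_one]
  omega

/-- On the circle `B` is unimodular, so the smaller power can be moved across the inner product,
leaving a positive power of `B` on one side. -/
lemma inner_mulCLM_blaschkePow {e e' : L2} (he : e ∈ blaschkeModel lam 1)
    (he' : e' ∈ blaschkeModel lam 1) (m k : ℤ) :
    ⟪mulCLM (blaschkePow lam m) e, mulCLM (blaschkePow lam k) e'⟫_ℂ =
      if m = k then ⟪e, e'⟫_ℂ else 0 := by
  rcases lt_trichotomy m k with h | h | h
  · rw [if_neg h.ne, inner_mulCLM_left, star_blaschkePow, mulCLM_blaschkePow_add, ← inner_conj_symm,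
      inner_mulCLM_blaschkePow_eq_zero lam he'.1 he (by omega), map_zero]
  · rw [if_pos h, h, inner_mulCLM_left, star_blaschkePow, mulCLM_blaschkePow_add, neg_add_cancel,
      blaschkePow_zero, mulCLM_one]
  · have := inner_mulCLM_left (star (blaschkePow lam k)) (mulCLM (blaschkePow lam m) e) e'
    rw [star_star, star_blaschkePow, mulCLM_blaschkePow_add] at this
    rw [if_neg h.ne', ← this, inner_mulCLM_blaschkePow_eq_zero lam he.1 he' (by omega)]

lemma mulCLM_blaschkePow_mem_blaschkeModel {e : L2} (he : e ∈ blaschkeModel lam 1) {j n : ℕ}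
    (hj : j < n) : mulCLM (blaschkePow lam j) e ∈ blaschkeModel lam n := by
  refine ⟨mulCLM_blaschkePow_mem_hardy lam j he.1, (Submodule.mem_orthogonal _ _).2 fun u hu => ?_⟩
  obtain ⟨g, hg, rfl⟩ := (mem_mulHardy_blaschkePow lam).1 hu
  have := inner_mulCLM_left (star (blaschkePow lam j)) (mulCLM (blaschkePow lam n) g) e
  rw [star_star, star_blaschkePow, mulCLM_blaschkePow_add] at this
  rw [← this, inner_mulCLM_blaschkePow_eq_zero lam hg he (by omega)]

lemma polyMul_denPoly_modelGen (n k : ℕ) :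
    polyMul (denPoly lam n) (ContinuousMap.toLp 2 arc ℂ (modelGen lam n k)) =
      fourierLp 2 (k : ℤ) := by
  rw [polyMul_eq_mulCLM, mulCLM_toLp, fourierLp]
  congr 1
  ext t
  rw [ContinuousMap.mul_apply, fourier_eq_zpow, zpow_natCast]
  exact mul_div_cancel₀ _ (denPoly_ne_zero lam n t)

/-- Let `q` be the denominator of `B`. On the circle `B` times the conjugate of `z^k / q` equals
`z^{d-k} / q`, so pairing `z^k / q` with `B g` gives the Fourier coefficient of `g / q ∈ H²` of
index `k - d < 0`. -/
lemma modelGen_mem_blaschkeModel {k : ℕ} (hk : k < d) :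
    ContinuousMap.toLp 2 arc ℂ (modelGen lam 1 k) ∈ blaschkeModel lam 1 := by
  refine ⟨mem_hardy_of_polyMul_denPoly lam 1 ?_, (Submodule.mem_orthogonal _ _).2 fun u hu => ?_⟩
  · rw [polyMul_denPoly_modelGen]
    exact fourierLp_mem_hardy k
  obtain ⟨g, hg, rfl⟩ := (mem_mulHardy_blaschkePow lam).1 hu
  have hq : mulCLM (modelGen lam 1 0) g ∈ hardy := by
    refine mem_hardy_of_polyMul_denPoly lam 1 ?_
    convert hg
    rw [polyMul_eq_mulCLM, mulCLM_mulCLM]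
    refine Eq.trans ?_ (mulCLM_one g)
    congr 2
    ext t
    rw [ContinuousMap.mul_apply]
    simp only [modelGen, ContinuousMap.coe_mk, pow_zero, ContinuousMap.one_apply]
    exact mul_one_div_cancel (denPoly_ne_zero lam 1 t)
  rw [← inner_conj_symm, L2.inner_def, ← map_zero (starRingEnd ℂ), ← hq ((k : ℤ) - d) (by omega),
    fourierCoeff]
  congr 1
  refine integral_congr_ae ?_
  filter_upwards [mulCLM_ae (modelGen lam 1 0) g, mulCLM_ae (blaschkePow lam (1 : ℕ)) g,
    ContinuousMap.coeFn_toLp (p := 2) (𝕜 := ℂ) arc (modelGen lam 1 k)] with t h1 h2 h3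
  rw [h1, h2, h3, RCLike.inner_apply, smul_eq_mul, fourier_eq_zpow]
  have hz := pt_ne_zero t
  have hq := denPoly_ne_zero lam 1 t
  have hB := blaschkePow_mul_den lam 1 t
  have hz' : conj (pt t) = (pt t)⁻¹ := (Complex.inv_eq_conj (norm_pt t)).symm
  have hconj := congrArg conj (conj_num_mul lam 1 t)
  rw [map_mul, Complex.conj_conj, map_pow, hz', one_mul, inv_pow] at hconj
  have hnum : (numPoly lam 1).eval (pt t) ≠ 0 := by
    intro h0
    rw [h0, zero_mul, eq_comm, map_eq_zero] at hconj
    exact hq hconj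
  simp only [modelGen, ContinuousMap.coe_mk, map_div₀, map_pow, hz', inv_pow, ← hconj, pow_zero]
  rw [eq_div_of_mul_eq hq hB, neg_sub, zpow_sub₀ hz, zpow_natCast, zpow_natCast]
  field_simp

lemma finrank_blaschkeModel_le (n : ℕ) : Module.finrank ℂ (blaschkeModel lam n) ≤ n * d := by
  classical
  have : FiniteDimensional ℂ (Submodule.span ℂ ((fun k : ℕ =>
      ContinuousMap.toLp 2 arc ℂ (modelGen lam n k)) '' (Finset.range (n * d) : Set ℕ))) :=
    FiniteDimensional.span_of_finite ℂ (((Finset.range (n * d)).finite_toSet).image _)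
  refine (Submodule.finrank_mono (blaschkeModel_le_span lam n)).trans ?_
  rw [← Finset.coe_image]
  refine (finrank_span_finset_le_card _).trans (Finset.card_image_le.trans_eq ?_)
  simp

lemma finrank_blaschkeModel_one : Module.finrank ℂ (blaschkeModel lam 1) = d := by
  refine le_antisymm (by simpa using finrank_blaschkeModel_le lam 1) ?_
  let v : Fin d → blaschkeModel lam 1 := fun k => ⟨_, modelGen_mem_blaschkeModel lam k.2⟩
  have hv : LinearIndependent ℂ v := by
    -- Multiplication by the denominator turns the generators into distinct Fourier modes.
    refine LinearIndependent.of_comp ((mulCLM ⟨_, continuous_eval (denPoly lam 1)⟩ :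
      L2 →ₗ[ℂ] L2) ∘ₗ (blaschkeModel lam 1).subtype) ?_
    have : ((mulCLM ⟨_, continuous_eval (denPoly lam 1)⟩ :
        L2 →ₗ[ℂ] L2) ∘ₗ (blaschkeModel lam 1).subtype) ∘ v =
        (fourierLp 2 : ℤ → L2) ∘ fun k : Fin d => (k : ℤ) := by
      funext k
      exact (polyMul_eq_mulCLM _ _).symm.trans (polyMul_denPoly_modelGen lam 1 k)
    rw [this]
    refine orthonormal_fourier.linearIndependent.comp _ fun k l h => ?_
    exact Fin.ext (by exact_mod_cast h)
  simpa using hv.fintype_card_le_finrank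

/-- An orthonormal basis of `K_B` multiplied by `B^j`, `0 ≤ j < n`, is an orthonormal basis of
`K_{Bⁿ}`. -/
lemma exists_orthonormalBasis_blaschkeModel (n : ℕ) [NeZero n] :
    ∃ (e : OrthonormalBasis (Fin d) ℂ (blaschkeModel lam 1))
      (x : OrthonormalBasis (ZMod n × Fin d) ℂ (blaschkeModel lam n)),
      ∀ p, (x p : L2) = mulCLM (blaschkePow lam p.1.val) (e p.2) := by
  let e : OrthonormalBasis (Fin d) ℂ (blaschkeModel lam 1) :=
    (stdOrthonormalBasis ℂ (blaschkeModel lam 1)).reindex (finCongr (finrank_blaschkeModel_one lam))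
  let v : ZMod n × Fin d → blaschkeModel lam n := fun p =>
    ⟨_, mulCLM_blaschkePow_mem_blaschkeModel lam (e p.2).2 (ZMod.val_lt p.1)⟩
  have hv : Orthonormal ℂ v := by
    rw [orthonormal_iff_ite]
    intro p q
    rw [Submodule.coe_inner, inner_mulCLM_blaschkePow lam (e p.2).2 (e q.2).2, ← Submodule.coe_inner,
      orthonormal_iff_ite.1 e.orthonormal, ← ite_and]
    refine if_congr ?_ rfl rfl
    rw [Prod.ext_iff, Nat.cast_inj, (ZMod.val_injective n).eq_iff]
  -- The dimension bound `n * d` makes the orthonormal family complete; no direct decomposition of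
  -- `K_{Bⁿ}` is needed.
  have hcard : Module.finrank ℂ (blaschkeModel lam n) ≤ Fintype.card (ZMod n × Fin d) := by
    rw [Fintype.card_prod, ZMod.card, Fintype.card_fin]
    exact finrank_blaschkeModel_le lam n
  have hcard' := le_antisymm hv.linearIndependent.fintype_card_le_finrank hcard
  refine ⟨e, OrthonormalBasis.mk hv ?_, fun p => ?_⟩
  · exact (hv.linearIndependent.span_eq_top_of_card_eq_finrank' hcard').ge
  · rw [OrthonormalBasis.coe_mk]

end Hardy

/-! ### Matrix entries of the compressions -/

section Compression

/-- Both projections disappear, since `f` lies in `K` and in `H²`. -/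
lemma inner_compression (ϕ : L2) (K : Submodule ℂ L2) [FiniteDimensional ℂ K] (hK : K ≤ hardyInf)
    (f g : K) :
    ⟪f, compression ϕ K hK g⟫_ℂ = ∫ t, (ϕ t * (g : L2) t) * conj ((f : L2) t) ∂arc := by
  have h1 : ⟪f, compression ϕ K hK g⟫_ℂ =
      ⟪(f : L2), (memLp_mul ϕ (hK g.2).2).toLp _⟫_ℂ := by
    simp only [compression, toeplitz, LinearMap.comp_apply, LinearMap.coe_mk, AddHom.coe_mk,
      Submodule.coe_inner]
    refine (Submodule.inner_orthogonalProjectionOnto_eq_of_mem_left f _).trans ?_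
    exact Submodule.inner_orthogonalProjectionOnto_eq_of_mem_left
      (⟨f, (hK f.2).1⟩ : hardy) _
  rw [h1, L2.inner_def]
  refine integral_congr_ae ?_
  filter_upwards [MemLp.coeFn_toLp (memLp_mul ϕ (hK g.2).2)] with t ht
  rw [ht, RCLike.inner_apply]

lemma compression_isSymmetric {ϕ : L2} (hϕ : ∀ᵐ t ∂arc, (ϕ t).im = 0) (K : Submodule ℂ L2)
    [FiniteDimensional ℂ K] (hK : K ≤ hardyInf) : (compression ϕ K hK).IsSymmetric := by
  intro f g
  rw [← inner_conj_symm, inner_compression, inner_compression, ← integral_conj]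
  refine integral_congr_ae ?_
  filter_upwards [hϕ] with t ht
  rw [map_mul, map_mul, Complex.conj_conj, Complex.conj_eq_iff_im.2 ht]
  ring

/-- As a function of the symbol, a matrix entry is a continuous functional on `L²`, represented by
`f` times the conjugate of `g`. This allows the symbol to be expanded termwise. -/
lemma exists_inner_eq_integral (f : L2) {g : L2} (hg : MemLp g ∞ arc) :
    ∃ w : L2, ∀ ψ : L2, ⟪w, ψ⟫_ℂ = ∫ t, (ψ t * g t) * conj (f t) ∂arc := by
  have hg' : MemLp (fun t => conj (g t)) ∞ arc := hg.star
  refine ⟨(memLp_mul f hg').toLp _, fun ψ => ?_⟩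
  rw [L2.inner_def]
  refine integral_congr_ae ?_
  filter_upwards [MemLp.coeFn_toLp (memLp_mul f hg')] with t ht
  rw [ht, RCLike.inner_apply, map_mul, Complex.conj_conj]
  ring

variable {d : ℕ} (lam : Fin d → 𝔻)

/-- By continuity in the symbol only `ϕ = B^m` matters. It shifts `B^j e_i` to `B^{j+m} e_i`, so
orthogonality selects the single term `m = k - j` in equal blocks. -/
lemma isBlockToeplitz_blaschkeCompression {n : ℕ} [NeZero n]
    {e : OrthonormalBasis (Fin d) ℂ (blaschkeModel lam 1)}
    {x : OrthonormalBasis (ZMod n × Fin d) ℂ (blaschkeModel lam n)}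
    (hx : ∀ p, (x p : L2) = mulCLM (blaschkePow lam p.1.val) (e p.2)) {a : ℤ → ℂ} {ϕ : L2}
    (ha : HasSum (fun m : ℤ => a m • blaschkeLp lam m) ϕ) :
    IsBlockToeplitz x a (blaschkeCompression lam ϕ n) := by
  intro p q
  obtain ⟨w, hw⟩ := exists_inner_eq_integral (x q : L2) (blaschkeModel_le_hardyInf lam n (x p).2).2
  rw [blaschkeCompression, inner_compression, ← hw]
  have h1 := ha.mapL (innerSL ℂ w)
  have h2 : ∀ m : ℤ, ⟪w, blaschkeLp lam m⟫_ℂ =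
      if (q.1.val : ℤ) = m + p.1.val ∧ q.2 = p.2 then 1 else 0 := by
    intro m
    have h3 : ⟪w, blaschkeLp lam m⟫_ℂ = ⟪(x q : L2), mulCLM (blaschkePow lam m) (x p)⟫_ℂ := by
      rw [hw, L2.inner_def]
      refine integral_congr_ae ?_
      filter_upwards [mulCLM_ae (blaschkePow lam m) (x p),
        ContinuousMap.coeFn_toLp (p := 2) (𝕜 := ℂ) arc (blaschkePow lam m)] with t h3 h4
      rw [h3, RCLike.inner_apply, blaschkeLp, h4]
    rw [h3, hx, hx, mulCLM_blaschkePow_add, inner_mulCLM_blaschkePow lam (e q.2).2 (e p.2).2,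
      ← Submodule.coe_inner, orthonormal_iff_ite.1 e.orthonormal, ← ite_and]
  have h5 : HasSum (fun m => innerSL ℂ w (a m • blaschkeLp lam m))
      (if q.2 = p.2 then a ((q.1.val : ℤ) - p.1.val) else 0) := by
    have : (fun m => innerSL ℂ w (a m • blaschkeLp lam m)) =
        fun m => if m = (q.1.val : ℤ) - p.1.val then
          (if q.2 = p.2 then a ((q.1.val : ℤ) - p.1.val) else 0) else 0 := by
      funext m
      have h6 : (q.1.val : ℤ) = m + p.1.val ↔ m = (q.1.val : ℤ) - p.1.val := by omega
      rw [innerSL_apply_apply, inner_smul_right, h2]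
      simp only [h6]
      generalize (q.1.val : ℤ) - p.1.val = c
      by_cases h7 : m = c <;> by_cases h8 : q.2 = p.2 <;> simp [h7, h8]
    rw [this]
    exact hasSum_ite_eq _ _
  exact h1.unique h5

/-- Multiplication by a suitable nowhere vanishing element of `K_B` turns the powers of `B` into an
orthonormal family. -/
lemma exists_mul_orthonormal_blaschkeLp (hd : 0 < d) :
    ∃ w w' : C(Torus, ℂ), w' * w = 1 ∧
      Orthonormal ℂ fun m : ℤ => mulCLM w (blaschkeLp lam m) := by
  set u : L2 := ContinuousMap.toLp 2 arc ℂ (modelGen lam 1 0)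
  have hu : u ∈ blaschkeModel lam 1 := modelGen_mem_blaschkeModel lam hd
  have hu0 : (‖u‖ : ℂ) ≠ 0 := by
    intro h
    have h0 : u = 0 := by simpa using h
    have h1 := polyMul_denPoly_modelGen lam 1 0
    rw [polyMul_eq_mulCLM, show ContinuousMap.toLp 2 arc ℂ (modelGen lam 1 0) = u from rfl, h0,
      map_zero] at h1
    have h2 := (orthonormal_fourier (T := 2 * Real.pi)).1 0
    rw [show (fourierLp 2 (0 : ℤ) : L2) = 0 from h1.symm, norm_zero] at h2
    exact zero_ne_one h2
  -- `w` is `1 / q` normalised, with `q` the denominator of `B`; its inverse is a multiple of `q`.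
  refine ⟨(‖u‖ : ℂ)⁻¹ • modelGen lam 1 0, (‖u‖ : ℂ) • ⟨_, continuous_eval (denPoly lam 1)⟩, ?_, ?_⟩
  · rw [smul_mul_smul_comm, mul_inv_cancel₀ hu0, one_smul]
    ext t
    exact mul_div_cancel₀ _ (denPoly_ne_zero lam 1 t)
  · have h : ∀ m : ℤ, mulCLM ((‖u‖ : ℂ)⁻¹ • modelGen lam 1 0) (blaschkeLp lam m) =
        mulCLM (blaschkePow lam m) ((‖u‖ : ℂ)⁻¹ • u) := by
      intro m
      rw [blaschkeLp, map_smul, map_smul, smul_apply, mulCLM_toLp, mulCLM_toLp,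
        mul_comm (blaschkePow lam m)]
    have hmem := (blaschkeModel lam 1).smul_mem (‖u‖ : ℂ)⁻¹ hu
    rw [orthonormal_iff_ite]
    intro m k
    rw [h, h, inner_mulCLM_blaschkePow lam hmem hmem, inner_self_eq_norm_sq_to_K, norm_smul,
      norm_inv, Complex.norm_real, norm_norm, inv_mul_cancel₀ (by exact_mod_cast hu0)]
    simp

end Compression

theorem theorem13 {d : ℕ} (hd : 0 < d) (lam : Fin d → 𝔻) (ϕ : L2) (hϕ : ϕ ∈ spaceM₁ lam) :
    (∃! a : ℤ → ℂ, HasSum (fun n : ℤ => a n • blaschkeLp lam n) ϕ) ∧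
    ∀ a : ℤ → ℂ, HasSum (fun n : ℤ => a n • blaschkeLp lam n) ϕ →
      ∃ φ : L2, HasSum (fun n : ℤ => a n • (fourierLp 2 n : L2)) φ ∧
        SingularDistributed lam ϕ (fun t => ‖φ t‖) ∧
        ((∀ᵐ t ∂arc, (ϕ t).im = 0) → EigenDistributed lam ϕ φ) := by
  obtain ⟨w, w', hw, hon⟩ := exists_mul_orthonormal_blaschkeLp lam hd
  have hw' : ∀ f : L2, mulCLM w' (mulCLM w f) = f := fun f => by
    rw [mulCLM_mulCLM, hw, mulCLM_one]
  -- Multiplying the series by `w` makes it orthonormal, which forces the coefficients.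
  have hsum : ∀ a : ℤ → ℂ, HasSum (fun n : ℤ => a n • blaschkeLp lam n) ϕ →
      a = fun m => ⟪mulCLM w (blaschkeLp lam m), mulCLM w ϕ⟫_ℂ := by
    intro a ha
    have h1 := ha.mapL (mulCLM w)
    simp only [map_smul] at h1
    exact funext fun m => (hon.inner_eq_of_hasSum h1 m).symm
  have : Nonempty (Fin d) := ⟨⟨0, hd⟩⟩
  refine ⟨⟨fun m => ⟪mulCLM w (blaschkeLp lam m), mulCLM w ϕ⟫_ℂ, ?_, hsum⟩, fun a ha => ?_⟩
  -- Existence: `w ϕ` is expanded in the orthonormal family, and multiplication by `w'` carries the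
  -- expansion back to `ϕ`.
  · have hmem : mulCLM w ϕ ∈ (Submodule.span ℂ
        (Set.range fun m : ℤ => mulCLM w (blaschkeLp lam m))).topologicalClosure := by
      have h1 : (Submodule.span ℂ (Set.range (blaschkeLp lam))).map (mulCLM w : L2 →ₗ[ℂ] L2) =
          Submodule.span ℂ (Set.range fun m : ℤ => mulCLM w (blaschkeLp lam m)) := by
        rw [Submodule.map_span, ← Set.range_comp]
        rfl
      rw [← h1]
      exact map_mem_closure (mulCLM w).continuous hϕ fun f hf => ⟨f, hf, rfl⟩
    have h2 := (hon.hasSum_of_mem_closure_span hmem).mapL (mulCLM w')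
    simpa only [map_smul, hw'] using h2
  · have hsq : Summable fun m => ‖a m‖ ^ 2 := by
      rw [hsum a ha]
      exact Orthonormal.inner_products_summable _ hon
    have hφ := ((orthonormal_fourier (T := 2 * Real.pi)).summable_smul hsq).hasSum
    -- The boundary-column contribution, which does not depend on `n`.
    let R : ℕ → ℝ := fun M => 4 * (2 * M * (2 * (∑' m, ‖a m‖ ^ 2) +
      2 * (∑ m ∈ Finset.Icc (-M : ℤ) M, ‖a m‖) ^ 2))
    refine ⟨_, hφ, fun G hG hc => ?_, fun hreal G hG hc => ?_⟩
    · refine tendsto_integral_of_norm_sub_rootAvg_le hG hc (r := norm) lipschitzWith_one_norm hsq hφ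
        fun M => ⟨R M, fun ε C hC hmod n hn => ?_⟩
      have : NeZero n := ⟨hn⟩
      obtain ⟨e, x, hx⟩ := exists_orthonormalBasis_blaschkeModel lam n
      exact (isBlockToeplitz_blaschkeCompression lam hx ha).norm_mean_singularValues_sub_rootAvg_le
        hsq M hC hmod
    · refine tendsto_integral_of_norm_sub_rootAvg_le hG hc (r := id) LipschitzWith.id hsq hφ
        fun M => ⟨R M, fun ε C hC hmod n hn => ?_⟩
      have : NeZero n := ⟨hn⟩
      obtain ⟨e, x, hx⟩ := exists_orthonormalBasis_blaschkeModel lam n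
      exact (isBlockToeplitz_blaschkeCompression lam hx ha).norm_mean_roots_sub_rootAvg_le
        hsq (compression_isSymmetric hreal _ _) M hC hmod
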